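/- Everything is $C^\infty$ and $M$ is a (Hausdorff) manifold without boundary. A Courant algebroid is a quadruple $(E,g,\rho,\bigstar)$, where $E\to M$ is a vector bundle, $g$ is a non degenerate metric on $E$, $\rho:E\to TM$ is a bundle morphism (the anchor) and $\bigstar:\Gamma E\times\Gamma E\to\Gamma E$ is $\mathbb{R}$-bilinear, such that, with $\partial=\frac12\sharp_g\circ{}^t\rho:T^*M\to E$ and $\partial f=\partial(df)$, (1) $(\rho e)(g(e_1,e_2))=g(e\bigstar e_1,e_2)+g(e_1,e\bigstar e_2)$; (2) $e\bigstar e=\partial(g(e,e))$; (3) $e\bigstar(e_1\bigstar e_2)=(e\bigstar e_1)\bigstar e_2+e_1\bigstar(e\bigstar e_2)$. Its Courant bracket is $[e_1,e_2]=e_1\bigstar e_2-\partial(g(e_1,e_2))$. For a foliation with tangent bundle $L$, the big tangent bundle $\mathbf L=L\oplus(T^*M/\mathrm{ann}\,L)$ has the anchor $pr_L$, the metric $g((Y_1,[\alpha_1]),(Y_2,[\alpha_2]))=\frac12(\alpha_1(Y_2)+\alpha_2(Y_1))$, $\partial f=(0,[df])$, the bracket $$[(Y_1,[\alpha_1]),(Y_2,[\alpha_2])]=\big([Y_1,Y_2],\,[\mathfrak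 L_{Y_1}\alpha_2-\mathfrak L_{Y_2}\alpha_1+\tfrac12 d(\alpha_1(Y_2)-\alpha_2(Y_1))]\big)$$ and the Dorfman product $s_1\bigstar s_2=[s_1,s_2]+\partial(g(s_1,s_2))$. Proposition. Let $(M,\gamma,F)$ be a para-Hermitian manifold: $F\in\mathrm{End}(TM)$, $F^2=\mathrm{Id}$, the $\pm1$-eigenbundles $L,\bar L$ of $F$ have equal rank and are tangent to foliations, and $\gamma$ is a non degenerate symmetric $2$-covariant tensor field with $\gamma(FX,Y)=-\gamma(X,FY)$. Let $\omega(X,Y)=\gamma(X,FY)$, $i(X)\omega=\omega(X,\cdot)$, $\sharp_\omega=(X\mapsto i(X)\omega)^{-1}$, and write $X=X_L+X_{\bar L}$ with $X_L=pr_LX$, $X_{\bar L}=pr_{\bar L}X$. Let $pr_{\mathrm{ann}\,\bar L}\alpha=\alpha\circ pr_L$ and $pr_{\mathrm{ann}\,L}\alpha=\alpha\circ pr_{\bar L}$. Then $TM$ carries two Courant algebroid structures, as follows. (a) The first has the anchor $pr_L$, the metric $g_L(X,Y)=\frac12(\omega(X_{\bar L},Y_L)+\omega(Y_{\bar L},X_L))=\frac12\gamma(X,Y)$,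 $\partial_{(L,\bar L)}f=\sharp_\omega(pr_{\mathrm{ann}\,\bar L}df)$, and $$[X,Y]_{(L,\bar L)}=[X_L,Y_L]+\sharp_\omega pr_{\mathrm{ann}\,\bar L}\big[\mathfrak L_{X_L}i(Y_{\bar L})\omega-\mathfrak L_{Y_L}i(X_{\bar L})\omega+\tfrac12d(\omega(X,Y))\big]$$ $$=[X_L,Y_L]+pr_{\bar L}([X_L,Y_{\bar L}]+[X_{\bar L},Y_L])+\sharp_\omega pr_{\mathrm{ann}\,\bar L}\big[i(Y_{\bar L})\mathfrak L_{X_L}\omega-i(X_{\bar L})\mathfrak L_{Y_L}\omega+\tfrac12d(\omega(X,Y))\big],$$ while $X\bigstar_{(L,\bar L)}Y$ is given by the same two expressions with $\frac12d(\omega(X,Y))$ replaced by $d(\omega(X_{\bar L},Y_L))$. The map $X\mapsto(X_L,[i(X_{\bar L})\omega])$ is a linear isomorphism of $TM$ onto $\mathbf L$, with inverse $(Y,[\alpha])\mapsto Y+\sharp_\omega\alpha$ for $Y\in L$, $\alpha\in\mathrm{ann}\,\bar L$; it gives a bijection of the smooth sections, and it transforms the anchor, the metric, $\partial$, the bracket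 and the Dorfman product of this structure into those of $\mathbf L$. (b) The second is obtained by exchanging $L$ with $\bar L$ and replacing $\omega$ by $-\omega$. It has the anchor $pr_{\bar L}$, the same metric $\frac12\gamma$, that is, $-\frac12(\omega(X_L,Y_{\bar L})+\omega(Y_L,X_{\bar L}))$, $\partial_{(\bar L,L)}f=-\sharp_\omega(pr_{\mathrm{ann}\,L}df)$, and $$[X,Y]_{(\bar L,L)}=[X_{\bar L},Y_{\bar L}]+\sharp_\omega pr_{\mathrm{ann}\,L}\big[\mathfrak L_{X_{\bar L}}i(Y_L)\omega-\mathfrak L_{Y_{\bar L}}i(X_L)\omega+\tfrac12d(\omega(X,Y))\big]$$ $$=[X_{\bar L},Y_{\bar L}]+pr_L([X_{\bar L},Y_L]+[X_L,Y_{\bar L}])+\sharp_\omega pr_{\mathrm{ann}\,L}\big[i(Y_L)\mathfrak L_{X_{\bar L}}\omega-i(X_L)\mathfrak L_{Y_{\bar L}}\omega+\tfrac12d(\omega(X,Y))\big],$$ while $X\bigstar_{(\bar L,L)}Y$ is given by the same two expressions with $\frac12d(\omega(X,Y))$ replaced by $d(\omega(X_L,Y_{\bar L}))$. The map $X\mapsto(X_{\bar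 L},[-i(X_L)\omega])$ is a linear isomorphism of $TM$ onto the big tangent bundle of $\bar L$, with inverse $(Y,[\alpha])\mapsto Y-\sharp_\omega\alpha$ for $Y\in\bar L$, $\alpha\in\mathrm{ann}\,L$; it gives a bijection of the smooth sections and transforms the anchor, the metric, $\partial$, the bracket and the Dorfman product of this structure into those of that bundle. -/

import Mathlib

open Bundle
open scoped Manifold ContDiff Topology

set_option linter.unusedSectionVars false

noncomputable section

namespace ParaHerm

/-! ### Tensor fields, Lie derivatives and foliations on a smooth manifold -/

section Calculus

variable {E : Type*} [NormedAddCommGroup E] [NormedSpace ℝ E]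
  {H : Type*} [TopologicalSpace H] (I : ModelWithCorners ℝ E H)
  {M : Type*} [TopologicalSpace M] [ChartedSpace H M]

/-- A distribution `D` of tangent subspaces is integrable, that is, tangent to a foliation: around
every point there is a foliated chart, in which `D` is the constant distribution `K`
(so that the connected components of the slices parallel to `K` are the plaques). -/
def IsIntegrable (D : Π x : M, Submodule ℝ (TangentSpace I x)) : Prop :=
  ∀ x : M, ∃ e ∈ IsManifold.maximalAtlas I ∞ M, x ∈ e.source ∧ ∃ K : Submodule ℝ E,
    ∀ y ∈ e.source, ∀ v : TangentSpace I y, v ∈ D y ↔ (mfderiv I 𝓘(ℝ, E) (e.extend I) y v : E) ∈ K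

variable [IsManifold I ∞ M]

/-- A field of tangent vectors is smooth. -/
def SmoothVF (X : Π x : M, TangentSpace I x) : Prop :=
  ContMDiff I (I.prod 𝓘(ℝ, E)) ∞
    (fun x => TotalSpace.mk' E (E := fun x : M => TangentSpace I x) x (X x))

/-- A field of covectors is smooth, that is, it is a differential `1`-form. -/
def SmoothOneForm (α : Π x : M, TangentSpace I x →L[ℝ] ℝ) : Prop :=
  ContMDiff I (I.prod 𝓘(ℝ, E →L[ℝ] ℝ)) ∞
    (fun x => TotalSpace.mk' (E →L[ℝ] ℝ)
      (E := fun x : M => TangentSpace I x →L[ℝ] ℝ) x (α x))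

/-- A field of bilinear forms on the tangent spaces is smooth. -/
def SmoothBilin (b : Π x : M, TangentSpace I x →L[ℝ] TangentSpace I x →L[ℝ] ℝ) : Prop :=
  ContMDiff I (I.prod 𝓘(ℝ, E →L[ℝ] E →L[ℝ] ℝ)) ∞
    (fun x => TotalSpace.mk' (E →L[ℝ] E →L[ℝ] ℝ)
      (E := fun x : M => TangentSpace I x →L[ℝ] TangentSpace I x →L[ℝ] ℝ) x (b x))

/-- A field of endomorphisms of the tangent spaces is smooth. -/
def SmoothEndo (A : Π x : M, TangentSpace I x →L[ℝ] TangentSpace I x) : Prop :=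
  ContMDiff I (I.prod 𝓘(ℝ, E →L[ℝ] E)) ∞
    (fun x => TotalSpace.mk' (E →L[ℝ] E)
      (E := fun x : M => TangentSpace I x →L[ℝ] TangentSpace I x) x (A x))

variable [FiniteDimensional ℝ E]

/-- The expression `X (α V) - α [X, V]` at `x`; it is tensorial in `V`. -/
def lieOneAux (X : Π x : M, TangentSpace I x) (α : Π x : M, TangentSpace I x →L[ℝ] ℝ) (x : M)
    (V : Π x : M, TangentSpace I x) : ℝ :=
  mvfderiv I (fun y => α y (V y)) x (X x) - α x (VectorField.mlieBracket I X V x)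

open Classical in
/-- The Lie derivative `𝔏_X α` of a `1`-form: the `1`-form with
`(𝔏_X α)(V) = X (α V) - α [X, V]` for all vector fields `V` (see `lieOne_apply`). -/
def lieOne (X : Π x : M, TangentSpace I x) (α : Π x : M, TangentSpace I x →L[ℝ] ℝ) (x : M) :
    TangentSpace I x →L[ℝ] ℝ :=
  if h : TensorialAt I E (V := fun x : M => TangentSpace I x) (lieOneAux I X α x) x then
    TensorialAt.mkHom (lieOneAux I X α x) x h else 0

/-- The expression `X (b (V, W)) - b ([X, V], W) - b (V, [X, W])` at `x`; it is tensorial in `V`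
and `W`. -/
def lieTwoAux (X : Π x : M, TangentSpace I x)
    (b : Π x : M, TangentSpace I x →L[ℝ] TangentSpace I x →L[ℝ] ℝ) (x : M)
    (V W : Π x : M, TangentSpace I x) : ℝ :=
  mvfderiv I (fun y => b y (V y) (W y)) x (X x) - b x (VectorField.mlieBracket I X V x) (W x)
    - b x (V x) (VectorField.mlieBracket I X W x)

open Classical in
/-- The Lie derivative `𝔏_X b` of a field of bilinear forms: the field with
`(𝔏_X b)(V, W) = X (b (V, W)) - b ([X, V], W) - b (V, [X, W])` for all vector fields `V`, `W`
(see `lieTwo_apply`). -/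
def lieTwo (X : Π x : M, TangentSpace I x)
    (b : Π x : M, TangentSpace I x →L[ℝ] TangentSpace I x →L[ℝ] ℝ) (x : M) :
    TangentSpace I x →L[ℝ] TangentSpace I x →L[ℝ] ℝ :=
  if h : (∀ W : Π x : M, TangentSpace I x,
        MDifferentiableAt I (I.prod 𝓘(ℝ, E)) (fun y => TotalSpace.mk' E y (W y)) x →
          TensorialAt I E (V := fun x : M => TangentSpace I x) (lieTwoAux I X b x · W) x) ∧
      (∀ V : Π x : M, TangentSpace I x,
        MDifferentiableAt I (I.prod 𝓘(ℝ, E)) (fun y => TotalSpace.mk' E y (V y)) x →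
          TensorialAt I E (V := fun x : M => TangentSpace I x) (lieTwoAux I X b x V) x) then
    TensorialAt.mkHom₂ (lieTwoAux I X b x) x h.1 h.2 else 0

end Calculus

section LieFacts

variable {E : Type*} [NormedAddCommGroup E] [NormedSpace ℝ E] [FiniteDimensional ℝ E]
  {H : Type*} [TopologicalSpace H] {I : ModelWithCorners ℝ E H}
  {M : Type*} [TopologicalSpace M] [ChartedSpace H M] [IsManifold I ∞ M]
  {X : Π x : M, TangentSpace I x} {α : Π x : M, TangentSpace I x →L[ℝ] ℝ}
  {b : Π x : M, TangentSpace I x →L[ℝ] TangentSpace I x →L[ℝ] ℝ}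

theorem mdiff_one (hα : SmoothOneForm I α) {V : Π x : M, TangentSpace I x} {x : M}
    (hV : MDifferentiableAt I (I.prod 𝓘(ℝ, E)) (fun y => TotalSpace.mk' E y (V y)) x) :
    MDifferentiableAt I 𝓘(ℝ, ℝ) (fun y => α y (V y)) x := by
  have h := (hα.contMDiffAt (x := x)).mdifferentiableAt (by simp)
  have := MDifferentiableAt.clm_bundle_apply (E₂ := Bundle.Trivial M ℝ) (F₂ := ℝ) h hV
  exact ((mdifferentiableAt_totalSpace _ _).1 this).2

theorem mdiff_two (hb : SmoothBilin I b) {V W : Π x : M, TangentSpace I x} {x : M}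
    (hV : MDifferentiableAt I (I.prod 𝓘(ℝ, E)) (fun y => TotalSpace.mk' E y (V y)) x)
    (hW : MDifferentiableAt I (I.prod 𝓘(ℝ, E)) (fun y => TotalSpace.mk' E y (W y)) x) :
    MDifferentiableAt I 𝓘(ℝ, ℝ) (fun y => b y (V y) (W y)) x := by
  have h := (hb.contMDiffAt (x := x)).mdifferentiableAt (by simp)
  have := MDifferentiableAt.clm_bundle_apply₂ (E₃ := Bundle.Trivial M ℝ) (F₃ := ℝ) h hV hW
  exact ((mdifferentiableAt_totalSpace _ _).1 this).2

theorem lieOneAux_tensorial (hα : SmoothOneForm I α) (x : M) :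
    TensorialAt I E (V := fun x : M => TangentSpace I x) (lieOneAux I X α x) x where
  smul {f V} hf hV := by
    have := FiniteDimensional.complete ℝ E
    have h : mvfderiv I (fun y => α y ((f • V) y)) x
        = mvfderiv I (f * fun y => α y (V y)) x := by
      congr 1; funext y; simp
    have h1 := mvfderiv_mul hf (mdiff_one hα hV)
    have h2 := VectorField.mlieBracket_smul_right (V := X) hf hV
    simp only [lieOneAux, h, h1, h2]
    simp
    ring
  add {V V'} hV hV' := by
    have := FiniteDimensional.complete ℝ E
    have h : mvfderiv I (fun y => α y ((V + V') y)) x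
        = mvfderiv I ((fun y => α y (V y)) + fun y => α y (V' y)) x := by
      congr 1; funext y; simp
    have h1 := mvfderiv_add (mdiff_one hα hV) (mdiff_one hα hV')
    have h2 := VectorField.mlieBracket_add_right (V := X) hV hV'
    simp only [lieOneAux, h, h1, h2]
    simp
    ring

/-- The characteristic formula of the Lie derivative of a `1`-form. -/
theorem lieOne_apply (hα : SmoothOneForm I α) {V : Π x : M, TangentSpace I x} {x : M}
    (hV : MDifferentiableAt I (I.prod 𝓘(ℝ, E)) (fun y => TotalSpace.mk' E y (V y)) x) :
    lieOne I X α x (V x) = mvfderiv I (fun y => α y (V y)) x (X x)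
      - α x (VectorField.mlieBracket I X V x) := by
  rw [lieOne, dif_pos (lieOneAux_tensorial hα x)]
  exact TensorialAt.mkHom_apply (lieOneAux_tensorial hα x) hV

theorem lieTwoAux_tensorial_left (hb : SmoothBilin I b) (x : M) (W : Π x : M, TangentSpace I x)
    (hW : MDifferentiableAt I (I.prod 𝓘(ℝ, E)) (fun y => TotalSpace.mk' E y (W y)) x) :
    TensorialAt I E (V := fun x : M => TangentSpace I x) (lieTwoAux I X b x · W) x where
  smul {f V} hf hV := by
    have := FiniteDimensional.complete ℝ E
    have h : mvfderiv I (fun y => b y ((f • V) y) (W y)) x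
        = mvfderiv I (f * fun y => b y (V y) (W y)) x := by
      congr 1; funext y; simp
    have h1 := mvfderiv_mul hf (mdiff_two hb hV hW)
    have h2 := VectorField.mlieBracket_smul_right (V := X) hf hV
    simp only [lieTwoAux, h, h1, h2]
    simp
    ring
  add {V V'} hV hV' := by
    have := FiniteDimensional.complete ℝ E
    have h : mvfderiv I (fun y => b y ((V + V') y) (W y)) x
        = mvfderiv I ((fun y => b y (V y) (W y)) + fun y => b y (V' y) (W y)) x := by
      congr 1; funext y; simp
    have h1 := mvfderiv_add (mdiff_two hb hV hW) (mdiff_two hb hV' hW)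
    have h2 := VectorField.mlieBracket_add_right (V := X) hV hV'
    simp only [lieTwoAux, h, h1, h2]
    simp
    ring

theorem lieTwoAux_tensorial_right (hb : SmoothBilin I b) (x : M) (V : Π x : M, TangentSpace I x)
    (hV : MDifferentiableAt I (I.prod 𝓘(ℝ, E)) (fun y => TotalSpace.mk' E y (V y)) x) :
    TensorialAt I E (V := fun x : M => TangentSpace I x) (lieTwoAux I X b x V) x where
  smul {f W} hf hW := by
    have := FiniteDimensional.complete ℝ E
    have h : mvfderiv I (fun y => b y (V y) ((f • W) y)) x
        = mvfderiv I (f * fun y => b y (V y) (W y)) x := by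
      congr 1; funext y; simp
    have h1 := mvfderiv_mul hf (mdiff_two hb hV hW)
    have h2 := VectorField.mlieBracket_smul_right (V := X) hf hW
    simp only [lieTwoAux, h, h1, h2]
    simp
    ring
  add {W W'} hW hW' := by
    have := FiniteDimensional.complete ℝ E
    have h : mvfderiv I (fun y => b y (V y) ((W + W') y)) x
        = mvfderiv I ((fun y => b y (V y) (W y)) + fun y => b y (V y) (W' y)) x := by
      congr 1; funext y; simp
    have h1 := mvfderiv_add (mdiff_two hb hV hW) (mdiff_two hb hV hW')
    have h2 := VectorField.mlieBracket_add_right (V := X) hW hW'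
    simp only [lieTwoAux, h, h1, h2]
    simp
    ring

/-- The characteristic formula of the Lie derivative of a field of bilinear forms. -/
theorem lieTwo_apply (hb : SmoothBilin I b) {V W : Π x : M, TangentSpace I x} {x : M}
    (hV : MDifferentiableAt I (I.prod 𝓘(ℝ, E)) (fun y => TotalSpace.mk' E y (V y)) x)
    (hW : MDifferentiableAt I (I.prod 𝓘(ℝ, E)) (fun y => TotalSpace.mk' E y (W y)) x) :
    lieTwo I X b x (V x) (W x) = mvfderiv I (fun y => b y (V y) (W y)) x (X x)
      - b x (VectorField.mlieBracket I X V x) (W x)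
      - b x (V x) (VectorField.mlieBracket I X W x) := by
  rw [lieTwo, dif_pos ⟨lieTwoAux_tensorial_left hb x, lieTwoAux_tensorial_right hb x⟩]
  exact TensorialAt.mkHom₂_apply (lieTwoAux_tensorial_left hb x)
    (lieTwoAux_tensorial_right hb x) hV hW

end LieFacts

/-! ### Courant algebroids -/

/-- The musical isomorphism `♯_b`, the inverse of `♭_b : v ↦ i(v) b = b (v, ·)`, for a
non degenerate bilinear form `b` on a finite dimensional space. -/
def sharp {W : Type*} [AddCommGroup W] [Module ℝ W] [TopologicalSpace W]
    [IsTopologicalAddGroup W] [ContinuousSMul ℝ W] (b : W →L[ℝ] W →L[ℝ] ℝ) :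
    (W →L[ℝ] ℝ) →L[ℝ] W :=
  b.inverse

section Courant

variable {E : Type*} [NormedAddCommGroup E] [NormedSpace ℝ E]
  {H : Type*} [TopologicalSpace H] (I : ModelWithCorners ℝ E H)
  {M : Type*} [TopologicalSpace M] [ChartedSpace H M] [IsManifold I ∞ M]
  (F : Type*) [NormedAddCommGroup F] [NormedSpace ℝ F]
  (V : M → Type*) [∀ x, AddCommGroup (V x)] [∀ x, Module ℝ (V x)]
  [∀ x, TopologicalSpace (V x)] [∀ x, IsTopologicalAddGroup (V x)]
  [∀ x, ContinuousSMul ℝ (V x)] [TopologicalSpace (TotalSpace F V)] [FiberBundle F V]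
  [VectorBundle ℝ F V] [FiniteDimensional ℝ F] [ContMDiffVectorBundle ∞ F V I]

/-- The morphism `∂ = (1/2) ♯_g ∘ ᵗρ : T*M → V` defined by a metric and an anchor. -/
def coanchor {V : M → Type*} [∀ x, AddCommGroup (V x)] [∀ x, Module ℝ (V x)]
    [∀ x, TopologicalSpace (V x)] [∀ x, IsTopologicalAddGroup (V x)]
    [∀ x, ContinuousSMul ℝ (V x)]
    (g : Π x : M, V x →L[ℝ] V x →L[ℝ] ℝ) (ρ : Π x : M, V x →L[ℝ] TangentSpace I x) (x : M)
    (α : TangentSpace I x →L[ℝ] ℝ) : V x :=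
  (1 / 2 : ℝ) • sharp (g x) (α.comp (ρ x))

/-- A Courant algebroid structure on a smooth vector bundle `V → M` with fibre `F`: a smooth
(pseudo-Euclidean) metric, a smooth anchor `V → TM` and a Dorfman bracket on the space of smooth
sections. -/
structure CourantAlgebroid where
  /-- the metric `g` -/
  metric : Π x : M, V x →L[ℝ] V x →L[ℝ] ℝ
  metric_smooth : ContMDiff I (I.prod 𝓘(ℝ, F →L[ℝ] F →L[ℝ] ℝ)) ∞
    (fun x => TotalSpace.mk' (F →L[ℝ] F →L[ℝ] ℝ)
      (E := fun x : M => V x →L[ℝ] V x →L[ℝ] ℝ) x (metric x))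
  metric_symm : ∀ x (v w : V x), metric x v w = metric x w v
  metric_nondegenerate : ∀ x (v : V x), (∀ w : V x, metric x v w = 0) → v = 0
  /-- the anchor `ρ` -/
  anchor : Π x : M, V x →L[ℝ] TangentSpace I x
  anchor_smooth : ContMDiff I (I.prod 𝓘(ℝ, F →L[ℝ] E)) ∞
    (fun x => TotalSpace.mk' (F →L[ℝ] E)
      (E := fun x : M => V x →L[ℝ] TangentSpace I x) x (anchor x))
  /-- the Dorfman bracket `⋆`, an `ℝ`-bilinear operation -/
  dorfman : Cₛ^∞⟮I; F, V⟯ →ₗ[ℝ] Cₛ^∞⟮I; F, V⟯ →ₗ[ℝ] Cₛ^∞⟮I; F, V⟯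
  /-- `(ρ e) (g (e₁, e₂)) = g (e ⋆ e₁, e₂) + g (e₁, e ⋆ e₂)` -/
  compatibility : ∀ (e e₁ e₂ : Cₛ^∞⟮I; F, V⟯) (x : M),
    mvfderiv I (fun y => metric y (e₁ y) (e₂ y)) x (anchor x (e x))
      = metric x (dorfman e e₁ x) (e₂ x) + metric x (e₁ x) (dorfman e e₂ x)
  /-- `e ⋆ e = ∂ (g (e, e))` -/
  normalization : ∀ (e : Cₛ^∞⟮I; F, V⟯) (x : M),
    dorfman e e x = coanchor I metric anchor x (mvfderiv I (fun y => metric y (e y) (e y)) x)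
  /-- `e ⋆ (e₁ ⋆ e₂) = (e ⋆ e₁) ⋆ e₂ + e₁ ⋆ (e ⋆ e₂)` -/
  leibniz : ∀ e e₁ e₂ : Cₛ^∞⟮I; F, V⟯,
    dorfman e (dorfman e₁ e₂) = dorfman (dorfman e e₁) e₂ + dorfman e₁ (dorfman e e₂)

namespace CourantAlgebroid

variable {I F V} (A : CourantAlgebroid I F V)

/-- `∂ f = ∂ (df)` for a function `f`. -/
def del (f : M → ℝ) (x : M) : V x := coanchor I A.metric A.anchor x (mvfderiv I f x)

/-- The Courant bracket `[e₁, e₂] = e₁ ⋆ e₂ - ∂ (g (e₁, e₂))`. -/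
def bracket (e₁ e₂ : Cₛ^∞⟮I; F, V⟯) (x : M) : V x :=
  A.dorfman e₁ e₂ x - A.del (fun y => A.metric y (e₁ y) (e₂ y)) x

end CourantAlgebroid

end Courant

/-! ### The big tangent bundle of a foliation -/

section Big

variable {E : Type*} [NormedAddCommGroup E] [NormedSpace ℝ E] [FiniteDimensional ℝ E]
  {H : Type*} [TopologicalSpace H] (I : ModelWithCorners ℝ E H)
  {M : Type*} [TopologicalSpace M] [ChartedSpace H M] [IsManifold I ∞ M]
  (D : Π x : M, Submodule ℝ (TangentSpace I x))

/-- The annihilator of `D x` in the cotangent space. -/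
def ann (x : M) : Submodule ℝ (TangentSpace I x →L[ℝ] ℝ) where
  carrier := {α | ∀ v ∈ D x, α v = 0}
  add_mem' ha hb v hv := by simp [ha v hv, hb v hv]
  zero_mem' v _ := rfl
  smul_mem' c a ha v hv := by simp [ha v hv]

/-- The fibre at `x` of the big tangent bundle `D ⊕ (T*M / ann D)` of the foliation tangent
to `D`. -/
abbrev BigTangent (x : M) : Type _ := D x × ((TangentSpace I x →L[ℝ] ℝ) ⧸ ann I D x)

/-- The class of a covector modulo `ann D`. -/
def cls (x : M) : (TangentSpace I x →L[ℝ] ℝ) →ₗ[ℝ] (TangentSpace I x →L[ℝ] ℝ) ⧸ ann I D x :=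
  (ann I D x).mkQ

/-- The pairing `([α], Y) ↦ α (Y)` of `T*M / ann D` with `D`. -/
def pairing (x : M) : ((TangentSpace I x →L[ℝ] ℝ) ⧸ ann I D x) →ₗ[ℝ] D x →ₗ[ℝ] ℝ :=
  (ann I D x).liftQ
    { toFun := fun α => (α : TangentSpace I x →ₗ[ℝ] ℝ).comp (D x).subtype
      map_add' := fun _ _ => rfl
      map_smul' := fun _ _ => rfl }
    (fun α hα => by ext v; exact hα v.1 v.2)

/-- The metric `g ((Y₁, [α₁]), (Y₂, [α₂])) = (1/2) (α₁ (Y₂) + α₂ (Y₁))`. -/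
def bigMetric (x : M) (s₁ s₂ : BigTangent I D x) : ℝ :=
  (1 / 2) * (pairing I D x s₁.2 s₂.1 + pairing I D x s₂.2 s₁.1)

/-- `∂ f = (0, [df])`. -/
def bigDel (f : M → ℝ) (x : M) : BigTangent I D x := (0, cls I D x (mvfderiv I f x))

/-- The `1`-form `α` represents the second component of the section `s`. -/
def Represents (α : Π x : M, TangentSpace I x →L[ℝ] ℝ) (s : Π x : M, BigTangent I D x) : Prop :=
  SmoothOneForm I α ∧ ∀ x, cls I D x (α x) = (s x).2

/-- `s` is a smooth section `(Y, [α])` of the big tangent bundle of the foliation: `Y` is a smooth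
vector field tangent to `D`, and `α` is a smooth `1`-form on `M`. -/
def SmoothBig (s : Π x : M, BigTangent I D x) : Prop :=
  SmoothVF I (fun x => ((s x).1 : TangentSpace I x)) ∧ ∃ α, Represents I D α s

/-- `s` is the Courant bracket of the smooth sections `s₁ = (Y₁, [α₁])` and `s₂ = (Y₂, [α₂])`:
`s = ([Y₁, Y₂], [𝔏_{Y₁} α₂ - 𝔏_{Y₂} α₁ + (1/2) d (α₁ (Y₂) - α₂ (Y₁))])`, for every choice
of the representatives `α₁`, `α₂`. -/
def IsBigBracket (s₁ s₂ s : Π x : M, BigTangent I D x) : Prop :=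
  SmoothBig I D s₁ ∧ SmoothBig I D s₂ ∧ SmoothBig I D s ∧
  ∀ α₁ α₂ : Π x : M, TangentSpace I x →L[ℝ] ℝ, Represents I D α₁ s₁ → Represents I D α₂ s₂ →
    ∀ x : M,
      ((s x).1 : TangentSpace I x) = VectorField.mlieBracket I
        (fun y => ((s₁ y).1 : TangentSpace I y)) (fun y => ((s₂ y).1 : TangentSpace I y)) x ∧
      (s x).2 = cls I D x
        (lieOne I (fun y => ((s₁ y).1 : TangentSpace I y)) α₂ x
          - lieOne I (fun y => ((s₂ y).1 : TangentSpace I y)) α₁ x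
          + (1 / 2 : ℝ) • mvfderiv I (fun y => α₁ y (s₂ y).1 - α₂ y (s₁ y).1) x)

/-- `s` is the Dorfman bracket `[s₁, s₂] + ∂ (g (s₁, s₂))` of the smooth sections `s₁`, `s₂`. -/
def IsBigDorfman (s₁ s₂ s : Π x : M, BigTangent I D x) : Prop :=
  IsBigBracket I D s₁ s₂
    (fun x => s x - bigDel I D (fun y => bigMetric I D y (s₁ y) (s₂ y)) x)

/-- The fibrewise linear maps `Φ x : T_x M → D x ⊕ (T*_x M / ann D x)` identify `TM`, with its
Courant algebroid structure `A`, with the big tangent bundle of the foliation tangent to `D`, with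
its natural structure. -/
structure IsTransfer (A : CourantAlgebroid I E (TangentSpace I : M → Type _))
    (Φ : Π x : M, TangentSpace I x →ₗ[ℝ] BigTangent I D x) : Prop where
  bijective : ∀ x, Function.Bijective (Φ x)
  smooth_iff : ∀ X : Π x : M, TangentSpace I x,
    SmoothVF I X ↔ SmoothBig I D (fun x => Φ x (X x))
  anchor : ∀ x (v : TangentSpace I x), A.anchor x v = ((Φ x v).1 : TangentSpace I x)
  metric : ∀ x (v w : TangentSpace I x), A.metric x v w = bigMetric I D x (Φ x v) (Φ x w)
  del : ∀ f : M → ℝ, ContMDiff I 𝓘(ℝ, ℝ) ∞ f → ∀ x, Φ x (A.del f x) = bigDel I D f x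
  bracket : ∀ X Y : Cₛ^∞⟮I; E, (TangentSpace I : M → Type _)⟯,
    IsBigBracket I D (fun x => Φ x (X x)) (fun x => Φ x (Y x)) (fun x => Φ x (A.bracket X Y x))
  dorfman : ∀ X Y : Cₛ^∞⟮I; E, (TangentSpace I : M → Type _)⟯,
    IsBigDorfman I D (fun x => Φ x (X x)) (fun x => Φ x (Y x)) (fun x => Φ x (A.dorfman X Y x))

end Big

/-! ### Para-Hermitian manifolds -/

section Para

variable {E : Type*} [NormedAddCommGroup E] [NormedSpace ℝ E] [FiniteDimensional ℝ E]
  {H : Type*} [TopologicalSpace H] (I : ModelWithCorners ℝ E H)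
  (M : Type*) [TopologicalSpace M] [ChartedSpace H M] [IsManifold I ∞ M]

/-- A para-Hermitian structure `(γ, F)` on `M`: a para-complex structure `F` and a compatible
pseudo-Riemannian metric `γ`. -/
structure ParaHermitian where
  /-- the almost para-complex structure -/
  F : Π x : M, TangentSpace I x →L[ℝ] TangentSpace I x
  F_smooth : SmoothEndo I F
  F_sq : ∀ x (v : TangentSpace I x), F x (F x v) = v
  /-- the eigenbundles of `F` have equal ranks -/
  rank_eq : ∀ x,
    Module.finrank ℝ (Module.End.eigenspace (F x : TangentSpace I x →ₗ[ℝ] TangentSpace I x) 1)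
      = Module.finrank ℝ
        (Module.End.eigenspace (F x : TangentSpace I x →ₗ[ℝ] TangentSpace I x) (-1))
  /-- the neutral metric -/
  γ : Π x : M, TangentSpace I x →L[ℝ] TangentSpace I x →L[ℝ] ℝ
  γ_smooth : SmoothBilin I γ
  γ_symm : ∀ x (v w : TangentSpace I x), γ x v w = γ x w v
  γ_nondegenerate : ∀ x (v : TangentSpace I x), (∀ w : TangentSpace I x, γ x v w = 0) → v = 0
  compatible : ∀ x (v w : TangentSpace I x), γ x (F x v) w = -γ x v (F x w)
  /-- the `+1`-eigenbundle is tangent to a foliation -/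
  integrable_plus : IsIntegrable I fun x =>
    Module.End.eigenspace (F x : TangentSpace I x →ₗ[ℝ] TangentSpace I x) 1
  /-- the `-1`-eigenbundle is tangent to a foliation -/
  integrable_minus : IsIntegrable I fun x =>
    Module.End.eigenspace (F x : TangentSpace I x →ₗ[ℝ] TangentSpace I x) (-1)

namespace ParaHermitian

variable {I M} (P : ParaHermitian I M)

/-- The Lagrangian foliation `L`, the `+1`-eigenbundle of `F`. -/
def L (x : M) : Submodule ℝ (TangentSpace I x) :=
  Module.End.eigenspace (P.F x : TangentSpace I x →ₗ[ℝ] TangentSpace I x) 1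

/-- The Lagrangian foliation `L̄`, the `-1`-eigenbundle of `F`. -/
def Lbar (x : M) : Submodule ℝ (TangentSpace I x) :=
  Module.End.eigenspace (P.F x : TangentSpace I x →ₗ[ℝ] TangentSpace I x) (-1)

/-- The projection `pr_L` of `TM = L ⊕ L̄`. -/
def prL (x : M) : TangentSpace I x →L[ℝ] TangentSpace I x :=
  (1 / 2 : ℝ) • (ContinuousLinearMap.id ℝ (TangentSpace I x) + P.F x)

/-- The projection `pr_L̄` of `TM = L ⊕ L̄`. -/
def prLbar (x : M) : TangentSpace I x →L[ℝ] TangentSpace I x :=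
  (1 / 2 : ℝ) • (ContinuousLinearMap.id ℝ (TangentSpace I x) - P.F x)

/-- The fundamental form `ω (X, Y) = γ (X, F Y)`. -/
def omega (x : M) : TangentSpace I x →L[ℝ] TangentSpace I x →L[ℝ] ℝ :=
  (ContinuousLinearMap.precomp ℝ (P.F x)).comp (P.γ x)

theorem omega_apply (x : M) (v w : TangentSpace I x) : P.omega x v w = P.γ x v (P.F x w) := rfl

theorem prL_mem (x : M) (v : TangentSpace I x) : P.prL x v ∈ P.L x := by
  rw [L, Module.End.mem_eigenspace_iff]
  simp [prL, P.F_sq, add_comm]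

theorem prLbar_mem (x : M) (v : TangentSpace I x) : P.prLbar x v ∈ P.Lbar x := by
  rw [Lbar, Module.End.mem_eigenspace_iff]
  simp [prLbar, P.F_sq, ← smul_neg]

theorem prL_add_prLbar (x : M) (v : TangentSpace I x) : P.prL x v + P.prLbar x v = v := by
  simp [prL, prLbar]
  module

/-- The identification `X ↦ (X_L, [♭_ω X_L̄])` of `TM` with the big tangent bundle of `L`. -/
def toBigL (x : M) : TangentSpace I x →ₗ[ℝ] BigTangent I P.L x :=
  ((P.prL x : TangentSpace I x →ₗ[ℝ] TangentSpace I x).codRestrict (P.L x) (P.prL_mem x)).prod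
    ((cls I P.L x).comp ((P.omega x).comp (P.prLbar x) :
      TangentSpace I x →ₗ[ℝ] (TangentSpace I x →L[ℝ] ℝ)))

/-- The identification `X ↦ (X_L̄, [-♭_ω X_L])` of `TM` with the big tangent bundle of `L̄`
(the roles of `L`, `L̄` are exchanged and `ω` is replaced by `-ω`). -/
def toBigLbar (x : M) : TangentSpace I x →ₗ[ℝ] BigTangent I P.Lbar x :=
  ((P.prLbar x : TangentSpace I x →ₗ[ℝ] TangentSpace I x).codRestrict (P.Lbar x)
      (P.prLbar_mem x)).prod
    ((cls I P.Lbar x).comp ((-P.omega x).comp (P.prL x) :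
      TangentSpace I x →ₗ[ℝ] (TangentSpace I x →L[ℝ] ℝ)))

end ParaHermitian

/-! ### The explicit operations

In the following formulas `p` and `q` are the projections of a decomposition `TM = D ⊕ D'` onto
`D` and `D'`; then `α ↦ α ∘ p` is the projection `pr_{ann D'}` of `T*M = ann D ⊕ ann D'`. -/

variable {M}
variable (p q : Π x : M, TangentSpace I x →L[ℝ] TangentSpace I x)
  (w : Π x : M, TangentSpace I x →L[ℝ] TangentSpace I x →L[ℝ] ℝ) (X Y : Π x : M, TangentSpace I x)

/-- `[pX, pY] + ♯_w pr_{ann D'} [𝔏_{pX} i(qY)w - 𝔏_{pY} i(qX)w + df]`. -/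
def lieForm (f : M → ℝ) (x : M) : TangentSpace I x :=
  VectorField.mlieBracket I (fun y => p y (X y)) (fun y => p y (Y y)) x
  + sharp (w x) ((lieOne I (fun y => p y (X y)) (fun y => w y (q y (Y y))) x
      - lieOne I (fun y => p y (Y y)) (fun y => w y (q y (X y))) x
      + mvfderiv I f x).comp (p x))

/-- `[pX, pY] + q ([pX, qY] + [qX, pY])
  + ♯_w pr_{ann D'} [i(qY) 𝔏_{pX} w - i(qX) 𝔏_{pY} w + df]`. -/
def contractedForm (f : M → ℝ) (x : M) : TangentSpace I x :=
  VectorField.mlieBracket I (fun y => p y (X y)) (fun y => p y (Y y)) x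
  + q x (VectorField.mlieBracket I (fun y => p y (X y)) (fun y => q y (Y y)) x
      + VectorField.mlieBracket I (fun y => q y (X y)) (fun y => p y (Y y)) x)
  + sharp (w x) ((lieTwo I (fun y => p y (X y)) w x (q x (Y x))
      - lieTwo I (fun y => p y (Y y)) w x (q x (X x))
      + mvfderiv I f x).comp (p x))

end Para

end ParaHerm

end

noncomputable section

namespace ParaHerm

section Analysis

open VectorField Filter

variable {E : Type*} [NormedAddCommGroup E] [NormedSpace ℝ E] [FiniteDimensional ℝ E]
  {M : Type*} [TopologicalSpace M] [ChartedSpace E M] [IsManifold 𝓘(ℝ, E) ∞ M]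

theorem SmoothVF.mdifferentiableAt {X : Π x : M, TangentSpace 𝓘(ℝ, E) x}
    (hX : SmoothVF 𝓘(ℝ, E) X) (x : M) :
    MDifferentiableAt 𝓘(ℝ, E) (𝓘(ℝ, E).prod 𝓘(ℝ, E)) (fun y => TotalSpace.mk' E y (X y)) x :=
  (hX x).mdifferentiableAt (by simp)

theorem SmoothVF.mlieBracket {X Y : Π x : M, TangentSpace 𝓘(ℝ, E) x}
    (hX : SmoothVF 𝓘(ℝ, E) X) (hY : SmoothVF 𝓘(ℝ, E) Y) :
    SmoothVF 𝓘(ℝ, E) (mlieBracket 𝓘(ℝ, E) X Y) := by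
  have := FiniteDimensional.complete ℝ E
  have : IsManifold 𝓘(ℝ, E) ((∞ : WithTop ℕ∞) + 1) M := by simpa using ‹IsManifold 𝓘(ℝ, E) ∞ M›
  have : IsManifold 𝓘(ℝ, E) (minSmoothness ℝ 2) M := by simp; infer_instance
  exact fun x => ContMDiffAt.mlieBracket_vectorField (m := ⊤) (n := ⊤) (hX x) (hY x) (by simp)

/-- The derivative of a smooth function along a smooth vector field is smooth. -/
theorem SmoothVF.contMDiff_mvfderiv {X : Π x : M, TangentSpace 𝓘(ℝ, E) x} {f : M → ℝ}
    (hX : SmoothVF 𝓘(ℝ, E) X) (hf : ContMDiff 𝓘(ℝ, E) 𝓘(ℝ, ℝ) ∞ f) :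
    ContMDiff 𝓘(ℝ, E) 𝓘(ℝ, ℝ) ∞ (fun x => mvfderiv 𝓘(ℝ, E) f x (X x)) := by
  have h := hf.contMDiff_tangentMap (m := ∞) (by simp)
  exact contMDiff_snd_tangentBundle_modelSpace ℝ 𝓘(ℝ, ℝ) |>.comp (h.comp hX)

/-- `[X, Y] f = X (Y f) - Y (X f)`. -/
theorem mvfderiv_mlieBracket {X Y : Π x : M, TangentSpace 𝓘(ℝ, E) x} {f : M → ℝ} {x : M}
    (hX : SmoothVF 𝓘(ℝ, E) X) (hY : SmoothVF 𝓘(ℝ, E) Y)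
    (hf : ContMDiffAt 𝓘(ℝ, E) 𝓘(ℝ, ℝ) ∞ f x) :
    mvfderiv 𝓘(ℝ, E) f x (mlieBracket 𝓘(ℝ, E) X Y x)
      = mvfderiv 𝓘(ℝ, E) (fun y => mvfderiv 𝓘(ℝ, E) f y (Y y)) x (X x)
        - mvfderiv 𝓘(ℝ, E) (fun y => mvfderiv 𝓘(ℝ, E) f y (X y)) x (Y x) := by
  have := FiniteDimensional.complete ℝ E
  have : IsManifold 𝓘(ℝ, E) (minSmoothness ℝ 2) M := by simp; infer_instance
  set φ : E → M := ⇑(extChartAt 𝓘(ℝ, E) x).symm with hφ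
  set u := extChartAt 𝓘(ℝ, E) x x with hu
  have hux : φ u = x := extChartAt_to_inv x
  have hT : ∀ᶠ v in 𝓝 u, v ∈ (extChartAt 𝓘(ℝ, E) x).target :=
    (isOpen_extChartAt_target x).mem_nhds (mem_extChartAt_target x)
  have hinv : ∀ v ∈ (extChartAt 𝓘(ℝ, E) x).target,
      (mfderiv 𝓘(ℝ, E) 𝓘(ℝ, E) φ v).IsInvertible := fun v hv => by
    have := isInvertible_mfderivWithin_extChartAt_symm hv
    rwa [modelWithCornersSelf_coe, Set.range_id, mfderivWithin_univ] at this
  have hsmooth : ContMDiffAt 𝓘(ℝ, E) 𝓘(ℝ, E) ∞ φ u :=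
    (contMDiffOn_extChartAt_symm x).contMDiffAt hT
  have key : ∀ (g : M → ℝ) (Z : Π x : M, TangentSpace 𝓘(ℝ, E) x) (v : E),
      v ∈ (extChartAt 𝓘(ℝ, E) x).target → MDifferentiableAt 𝓘(ℝ, E) 𝓘(ℝ, ℝ) g (φ v) →
      mvfderiv 𝓘(ℝ, E) g (φ v) (Z (φ v))
        = fderiv ℝ (g ∘ φ) v (mpullback 𝓘(ℝ, E) 𝓘(ℝ, E) φ Z v) := by
    intro g Z v hv hg
    have h1 : MDifferentiableAt 𝓘(ℝ, E) 𝓘(ℝ, E) φ v :=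
      mdifferentiableAt_of_isInvertible_mfderiv (hinv v hv)
    rw [← mfderiv_eq_fderiv, mfderiv_comp v hg h1]
    have h2 : mfderiv 𝓘(ℝ, E) 𝓘(ℝ, E) φ v (mpullback 𝓘(ℝ, E) 𝓘(ℝ, E) φ Z v) = Z (φ v) := by
      rw [mpullback_apply, ← ContinuousLinearMap.comp_apply, (hinv v hv).self_comp_inverse]
      rfl
    change _ = mfderiv 𝓘(ℝ, E) 𝓘(ℝ, ℝ) g (φ v)
      (mfderiv 𝓘(ℝ, E) 𝓘(ℝ, E) φ v (mpullback 𝓘(ℝ, E) 𝓘(ℝ, E) φ Z v))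
    rw [h2]
    rfl
  have hfu : ContMDiffAt 𝓘(ℝ, E) 𝓘(ℝ, ℝ) ∞ f (φ u) := hux ▸ hf
  have hfφ : ContDiffAt ℝ ∞ (f ∘ φ) u := (hfu.comp u hsmooth).contDiffAt
  have hpull : ∀ Z : Π x : M, TangentSpace 𝓘(ℝ, E) x, SmoothVF 𝓘(ℝ, E) Z →
      DifferentiableAt ℝ (mpullback 𝓘(ℝ, E) 𝓘(ℝ, E) φ Z) u := by
    intro Z hZ
    exact (contMDiffAt_vectorSpace_iff_contDiffAt.1
      (ContMDiffAt.mpullback_vectorField_preimage (m := ∞) (hZ _) hsmooth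
        (hinv u (mem_extChartAt_target x)) (by simp))).differentiableAt (by simp)
  have hev : ∀ Z : Π x : M, TangentSpace 𝓘(ℝ, E) x,
      (fun y => mvfderiv 𝓘(ℝ, E) f y (Z y)) ∘ φ
        =ᶠ[𝓝 u] fun v => fderiv ℝ (f ∘ φ) v (mpullback 𝓘(ℝ, E) 𝓘(ℝ, E) φ Z v) := by
    intro Z
    have h1 := (contMDiffAt_iff_contMDiffAt_nhds (by simp)).1
      (hfu.of_le (show (1 : WithTop ℕ∞) ≤ ∞ by simp))
    filter_upwards [hT, hsmooth.continuousAt.eventually h1] with v hv hfv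
    exact key f Z v hv (hfv.mdifferentiableAt (by simp))
  have hmd : ∀ Z : Π x : M, TangentSpace 𝓘(ℝ, E) x, SmoothVF 𝓘(ℝ, E) Z →
      MDifferentiableAt 𝓘(ℝ, E) 𝓘(ℝ, ℝ) (fun y => mvfderiv 𝓘(ℝ, E) f y (Z y)) (φ u) := by
    intro Z hZ
    have h1 : DifferentiableAt ℝ
        (fun v => fderiv ℝ (f ∘ φ) v (mpullback 𝓘(ℝ, E) 𝓘(ℝ, E) φ Z v)) u :=
      ((hfφ.fderiv_right (m := ∞) (by simp)).differentiableAt (by simp)).clm_apply (hpull Z hZ)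
    have h2 : MDifferentiableAt 𝓘(ℝ, E) 𝓘(ℝ, E) (extChartAt 𝓘(ℝ, E) x) x :=
      mdifferentiableAt_extChartAt (mem_chart_source E x)
    rw [hux]
    refine (h1.mdifferentiableAt.comp x h2).congr_of_eventuallyEq ?_
    filter_upwards [(continuousAt_extChartAt (I := 𝓘(ℝ, E)) x).eventually (hev Z),
      extChartAt_source_mem_nhds (I := 𝓘(ℝ, E)) x] with y hy hys
    rw [Function.comp_apply, hφ, (extChartAt 𝓘(ℝ, E) x).left_inv hys] at hy
    exact hy
  have two_le : (2 : WithTop ℕ∞) ≤ ∞ := WithTop.coe_le_coe.2 le_top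
  have k0 := key f (mlieBracket 𝓘(ℝ, E) X Y) u (mem_extChartAt_target x)
    (hfu.mdifferentiableAt (by simp))
  have k1 := key _ X u (mem_extChartAt_target x) (hmd Y hY)
  have k2 := key _ Y u (mem_extChartAt_target x) (hmd X hX)
  rw [(hev Y).fderiv_eq] at k1
  rw [(hev X).fderiv_eq] at k2
  have hbr : mpullback 𝓘(ℝ, E) 𝓘(ℝ, E) φ (mlieBracket 𝓘(ℝ, E) X Y) u
      = lieBracket ℝ (mpullback 𝓘(ℝ, E) 𝓘(ℝ, E) φ X) (mpullback 𝓘(ℝ, E) 𝓘(ℝ, E) φ Y) u := by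
    rw [mpullback_mlieBracket (hX.mdifferentiableAt _) (hY.mdifferentiableAt _) hsmooth
      (by simpa using two_le), ← mlieBracketWithin_univ, mlieBracketWithin_eq_lieBracketWithin]
    exact congrFun (lieBracketWithin_univ (𝕜 := ℝ)) u
  rw [hbr, fderiv_apply_lieBracket hfφ (by simpa using two_le) (hpull Y hY) (hpull X hX),
    ← k1, ← k2, hux] at k0
  exact k0

theorem IsIntegrable.mlieBracket_mem {D : Π x : M, Submodule ℝ (TangentSpace 𝓘(ℝ, E) x)}
    (hD : IsIntegrable 𝓘(ℝ, E) D) {X Y : Π x : M, TangentSpace 𝓘(ℝ, E) x}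
    (hX : SmoothVF 𝓘(ℝ, E) X) (hY : SmoothVF 𝓘(ℝ, E) Y) (hXD : ∀ x, X x ∈ D x)
    (hYD : ∀ x, Y x ∈ D x) (x : M) : mlieBracket 𝓘(ℝ, E) X Y x ∈ D x := by
  obtain ⟨e, he, hx, K, hK⟩ := hD x
  rw [hK x hx]
  by_contra hnot
  obtain ⟨φ, hφ, hφK⟩ := Submodule.exists_le_ker_of_notMem hnot
  let φ' : E →L[ℝ] ℝ := (show E →ₗ[ℝ] ℝ from φ).toContinuousLinearMap
  set f : M → ℝ := fun y => φ' (e.extend 𝓘(ℝ, E) y) with hf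
  have hdf : ∀ y ∈ e.source, ∀ v : TangentSpace 𝓘(ℝ, E) y,
      mvfderiv 𝓘(ℝ, E) f y v = φ' (mfderiv 𝓘(ℝ, E) 𝓘(ℝ, E) (e.extend 𝓘(ℝ, E)) y v) := by
    intro y hy v
    have h1 := (OpenPartialHomeomorph.contMDiffAt_extend he hy).mdifferentiableAt (by simp)
    have h2 := mfderiv_comp y φ'.mdifferentiableAt h1
    rw [ContinuousLinearMap.mfderiv_eq] at h2
    exact congr($h2 v)
  have h0 : ∀ Z : Π x : M, TangentSpace 𝓘(ℝ, E) x, (∀ x, Z x ∈ D x) →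
      (fun y => mvfderiv 𝓘(ℝ, E) f y (Z y)) =ᶠ[𝓝 x] fun _ => 0 := by
    intro Z hZ
    filter_upwards [e.open_source.mem_nhds hx] with y hy
    rw [hdf y hy]
    exact hφK ((hK y hy _).1 (hZ y))
  have hfx : ContMDiffAt 𝓘(ℝ, E) 𝓘(ℝ, ℝ) ∞ f x :=
    φ'.contMDiff.contMDiffAt.comp x (OpenPartialHomeomorph.contMDiffAt_extend he hx)
  apply hφ
  have h := mvfderiv_mlieBracket hX hY hfx
  rw [hdf x hx] at h
  refine h.trans ?_
  have h2 : ∀ Z : Π x : M, TangentSpace 𝓘(ℝ, E) x, (∀ x, Z x ∈ D x) →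
      ∀ v : TangentSpace 𝓘(ℝ, E) x,
        mvfderiv 𝓘(ℝ, E) (fun y => mvfderiv 𝓘(ℝ, E) f y (Z y)) x v = 0 := by
    intro Z hZ v
    have h3 := (h0 Z hZ).mfderiv_eq (I := 𝓘(ℝ, E)) (I' := 𝓘(ℝ, ℝ))
    rw [mfderiv_const] at h3
    exact congr($h3 v)
  rw [h2 Y hYD, h2 X hXD, sub_zero]

end Analysis

section Smoothness

open VectorField Filter

variable {E : Type*} [NormedAddCommGroup E] [NormedSpace ℝ E] [FiniteDimensional ℝ E]
  {M : Type*} [TopologicalSpace M] [ChartedSpace E M] [IsManifold 𝓘(ℝ, E) ∞ M]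

theorem SmoothOneForm.apply {α : Π x : M, TangentSpace 𝓘(ℝ, E) x →L[ℝ] ℝ}
    {X : Π x : M, TangentSpace 𝓘(ℝ, E) x} (hα : SmoothOneForm 𝓘(ℝ, E) α)
    (hX : SmoothVF 𝓘(ℝ, E) X) : ContMDiff 𝓘(ℝ, E) 𝓘(ℝ, ℝ) ∞ (fun x => α x (X x)) := by
  intro x
  have := ContMDiffAt.clm_bundle_apply (E₂ := Bundle.Trivial M ℝ) (F₂ := ℝ) (hα x) (hX x)
  exact (contMDiffAt_totalSpace.1 this).2

theorem SmoothBilin.apply {b : Π x : M, TangentSpace 𝓘(ℝ, E) x →L[ℝ] TangentSpace 𝓘(ℝ, E) x →L[ℝ] ℝ}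
    {X : Π x : M, TangentSpace 𝓘(ℝ, E) x} (hb : SmoothBilin 𝓘(ℝ, E) b)
    (hX : SmoothVF 𝓘(ℝ, E) X) : SmoothOneForm 𝓘(ℝ, E) (fun x => b x (X x)) :=
  ContMDiff.clm_bundle_apply (E₂ := fun x : M => TangentSpace 𝓘(ℝ, E) x →L[ℝ] ℝ) hb hX

theorem SmoothEndo.apply {A : Π x : M, TangentSpace 𝓘(ℝ, E) x →L[ℝ] TangentSpace 𝓘(ℝ, E) x}
    {X : Π x : M, TangentSpace 𝓘(ℝ, E) x} (hA : SmoothEndo 𝓘(ℝ, E) A)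
    (hX : SmoothVF 𝓘(ℝ, E) X) : SmoothVF 𝓘(ℝ, E) (fun x => A x (X x)) :=
  ContMDiff.clm_bundle_apply (E₂ := fun x : M => TangentSpace 𝓘(ℝ, E) x) hA hX

/-- A vector of the model space extends to a global smooth vector field which is constant near `x`
in the trivialization of the tangent bundle at `x`. -/
theorem exists_smoothVF_eventually_eq_symm [T2Space M] (x : M) (v : E) :
    ∃ V : Π x : M, TangentSpace 𝓘(ℝ, E) x, SmoothVF 𝓘(ℝ, E) V ∧
      ∀ᶠ y in 𝓝 x, V y = (trivializationAt E (TangentSpace 𝓘(ℝ, E)) x).symm y v := by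
  let t := trivializationAt E (TangentSpace 𝓘(ℝ, E) : M → Type _) x
  obtain ⟨f⟩ : Nonempty (SmoothBumpFunction 𝓘(ℝ, E) x) := inferInstance
  have hs : ContMDiffOn 𝓘(ℝ, E) (𝓘(ℝ, E).prod 𝓘(ℝ, E)) ∞
      (fun y => TotalSpace.mk' E (E := fun x : M => TangentSpace 𝓘(ℝ, E) x) y (t.symm y v))
      t.baseSet := by
    suffices h : ContMDiffOn 𝓘(ℝ, E) 𝓘(ℝ, E) ∞ (fun y => (t ⟨y, t.symm y v⟩).2) t.baseSet by
      intro y hy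
      rw [t.contMDiffWithinAt_section _ hy]
      exact h y hy
    exact (contMDiffOn_const (c := v)).congr (fun y hy => by simp [hy])
  refine ⟨fun y => f y • t.symm y v, ?_, ?_⟩
  · exact ContMDiffOn.smul_section_of_tsupport (ψ := f) f.contMDiff.contMDiffOn t.open_baseSet
      f.tsupport_subset_chartAt_source hs
  · filter_upwards [f.eventuallyEq_one] with y hy
    simp [hy, t]

/-- Every tangent vector is a value of a global smooth vector field. -/
theorem exists_smoothVF_eq [T2Space M] (x : M) (v : TangentSpace 𝓘(ℝ, E) x) :
    ∃ V : Π x : M, TangentSpace 𝓘(ℝ, E) x, SmoothVF 𝓘(ℝ, E) V ∧ V x = v := by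
  let t := trivializationAt E (TangentSpace 𝓘(ℝ, E) : M → Type _) x
  obtain ⟨V, hV, h⟩ := exists_smoothVF_eventually_eq_symm x (t ⟨x, v⟩).2
  refine ⟨V, hV, h.self_of_nhds.trans ?_⟩
  exact t.symm_apply_apply_mk (FiberBundle.mem_baseSet_trivializationAt' x) v

theorem contMDiffAt_of_apply {G : Type*} [NormedAddCommGroup G] [NormedSpace ℝ G]
    {F : M → E →L[ℝ] G} {x : M}
    (h : ∀ v : E, ContMDiffAt 𝓘(ℝ, E) 𝓘(ℝ, G) ∞ (fun y => F y v) x) :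
    ContMDiffAt 𝓘(ℝ, E) 𝓘(ℝ, E →L[ℝ] G) ∞ F x := by
  let b := Module.finBasis ℝ E
  let s (i) : G →L[ℝ] E →L[ℝ] G :=
    ContinuousLinearMap.smulRightL ℝ E G (b.coord i).toContinuousLinearMap
  have hF : F = fun y => ∑ i, s i (F y (b i)) := by
    funext y
    ext v
    conv_lhs => rw [← b.sum_repr v, map_sum]
    simp [s]
  rw [hF]
  exact contMDiffAt_finsetSum fun i _ => (s i).contMDiff.contMDiffAt.comp x (h (b i))

/-- A morphism from the tangent bundle to a vector bundle is smooth if it maps smooth vector fields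
to smooth sections. -/
theorem contMDiff_hom_of_apply [T2Space M] {F : Type*} [NormedAddCommGroup F] [NormedSpace ℝ F]
    {V : M → Type*} [∀ x, AddCommGroup (V x)] [∀ x, Module ℝ (V x)] [∀ x, TopologicalSpace (V x)]
    [∀ x, IsTopologicalAddGroup (V x)] [∀ x, ContinuousSMul ℝ (V x)]
    [TopologicalSpace (TotalSpace F V)] [FiberBundle F V] [VectorBundle ℝ F V]
    {A : Π x : M, TangentSpace 𝓘(ℝ, E) x →L[ℝ] V x}
    (h : ∀ X : Π x : M, TangentSpace 𝓘(ℝ, E) x, SmoothVF 𝓘(ℝ, E) X →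
      ContMDiff 𝓘(ℝ, E) (𝓘(ℝ, E).prod 𝓘(ℝ, F)) ∞ (fun x => TotalSpace.mk' F x (A x (X x)))) :
    ContMDiff 𝓘(ℝ, E) (𝓘(ℝ, E).prod 𝓘(ℝ, E →L[ℝ] F)) ∞
      (fun x => TotalSpace.mk' (E →L[ℝ] F)
        (E := fun x : M => TangentSpace 𝓘(ℝ, E) x →L[ℝ] V x) x (A x)) := by
  intro x
  refine (contMDiffAt_hom_bundle _).2 ⟨contMDiffAt_id, ?_⟩
  refine contMDiffAt_of_apply fun v => ?_
  obtain ⟨X, hX, hXx⟩ := exists_smoothVF_eventually_eq_symm x v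
  refine (contMDiffAt_section x).1 (h X hX x) |>.congr_of_eventuallyEq ?_
  filter_upwards [hXx, (trivializationAt E (TangentSpace 𝓘(ℝ, E)) x).open_baseSet.mem_nhds
    (FiberBundle.mem_baseSet_trivializationAt' x),
    (trivializationAt F V x).open_baseSet.mem_nhds
    (FiberBundle.mem_baseSet_trivializationAt' x)] with y hy hyb hyc
  rw [hy, ContinuousLinearMap.inCoordinates_eq hyb hyc]
  simp

/-- A field of covectors is smooth if its values on smooth vector fields are smooth. -/
theorem smoothOneForm_of_apply [T2Space M] {α : Π x : M, TangentSpace 𝓘(ℝ, E) x →L[ℝ] ℝ}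
    (h : ∀ V : Π x : M, TangentSpace 𝓘(ℝ, E) x, SmoothVF 𝓘(ℝ, E) V →
      ContMDiff 𝓘(ℝ, E) 𝓘(ℝ, ℝ) ∞ (fun x => α x (V x))) : SmoothOneForm 𝓘(ℝ, E) α :=
  contMDiff_hom_of_apply (V := Bundle.Trivial M ℝ) fun X hX x =>
    (contMDiffAt_section x).2 (h X hX x)

theorem smoothOneForm_mvfderiv [T2Space M] {f : M → ℝ} (hf : ContMDiff 𝓘(ℝ, E) 𝓘(ℝ, ℝ) ∞ f) :
    SmoothOneForm 𝓘(ℝ, E) (mvfderiv 𝓘(ℝ, E) f) :=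
  smoothOneForm_of_apply fun _ hV => hV.contMDiff_mvfderiv hf

theorem SmoothOneForm.comp [T2Space M] {α : Π x : M, TangentSpace 𝓘(ℝ, E) x →L[ℝ] ℝ}
    {A : Π x : M, TangentSpace 𝓘(ℝ, E) x →L[ℝ] TangentSpace 𝓘(ℝ, E) x}
    (hα : SmoothOneForm 𝓘(ℝ, E) α) (hA : SmoothEndo 𝓘(ℝ, E) A) :
    SmoothOneForm 𝓘(ℝ, E) (fun x => (α x).comp (A x)) :=
  smoothOneForm_of_apply fun _ hV => hα.apply (hA.apply hV)

theorem smoothOneForm_lieOne [T2Space M] {X : Π x : M, TangentSpace 𝓘(ℝ, E) x}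
    {α : Π x : M, TangentSpace 𝓘(ℝ, E) x →L[ℝ] ℝ} (hX : SmoothVF 𝓘(ℝ, E) X)
    (hα : SmoothOneForm 𝓘(ℝ, E) α) : SmoothOneForm 𝓘(ℝ, E) (lieOne 𝓘(ℝ, E) X α) := by
  refine smoothOneForm_of_apply fun V hV => ?_
  simp only [fun x => lieOne_apply (X := X) hα (hV.mdifferentiableAt x)]
  exact (hX.contMDiff_mvfderiv (hα.apply hV)).sub (hα.apply (hX.mlieBracket hV))

theorem SmoothOneForm.add {α β : Π x : M, TangentSpace 𝓘(ℝ, E) x →L[ℝ] ℝ}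
    (hα : SmoothOneForm 𝓘(ℝ, E) α) (hβ : SmoothOneForm 𝓘(ℝ, E) β) :
    SmoothOneForm 𝓘(ℝ, E) (fun x => α x + β x) :=
  ContMDiff.add_section hα hβ

theorem SmoothOneForm.sub {α β : Π x : M, TangentSpace 𝓘(ℝ, E) x →L[ℝ] ℝ}
    (hα : SmoothOneForm 𝓘(ℝ, E) α) (hβ : SmoothOneForm 𝓘(ℝ, E) β) :
    SmoothOneForm 𝓘(ℝ, E) (fun x => α x - β x) :=
  ContMDiff.sub_section hα hβ

theorem SmoothOneForm.neg {α : Π x : M, TangentSpace 𝓘(ℝ, E) x →L[ℝ] ℝ}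
    (hα : SmoothOneForm 𝓘(ℝ, E) α) : SmoothOneForm 𝓘(ℝ, E) (fun x => -α x) :=
  ContMDiff.neg_section hα

theorem SmoothOneForm.const_smul {α : Π x : M, TangentSpace 𝓘(ℝ, E) x →L[ℝ] ℝ} (c : ℝ)
    (hα : SmoothOneForm 𝓘(ℝ, E) α) : SmoothOneForm 𝓘(ℝ, E) (fun x => c • α x) :=
  ContMDiff.const_smul_section hα

/-- A field of bilinear forms is smooth if its contractions with smooth vector fields are. -/
theorem smoothBilin_of_apply [T2Space M]
    {b : Π x : M, TangentSpace 𝓘(ℝ, E) x →L[ℝ] TangentSpace 𝓘(ℝ, E) x →L[ℝ] ℝ}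
    (h : ∀ V : Π x : M, TangentSpace 𝓘(ℝ, E) x, SmoothVF 𝓘(ℝ, E) V →
      SmoothOneForm 𝓘(ℝ, E) (fun x => b x (V x))) : SmoothBilin 𝓘(ℝ, E) b :=
  contMDiff_hom_of_apply (V := fun x : M => TangentSpace 𝓘(ℝ, E) x →L[ℝ] ℝ) h

theorem SmoothBilin.neg [T2Space M]
    {b : Π x : M, TangentSpace 𝓘(ℝ, E) x →L[ℝ] TangentSpace 𝓘(ℝ, E) x →L[ℝ] ℝ}
    (hb : SmoothBilin 𝓘(ℝ, E) b) : SmoothBilin 𝓘(ℝ, E) (fun x => -b x) :=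
  smoothBilin_of_apply fun _ hV => (hb.apply hV).neg

/-- A field of endomorphisms is smooth if it maps smooth vector fields to smooth vector fields. -/
theorem smoothEndo_of_apply [T2Space M]
    {A : Π x : M, TangentSpace 𝓘(ℝ, E) x →L[ℝ] TangentSpace 𝓘(ℝ, E) x}
    (h : ∀ V : Π x : M, TangentSpace 𝓘(ℝ, E) x, SmoothVF 𝓘(ℝ, E) V →
      SmoothVF 𝓘(ℝ, E) (fun x => A x (V x))) : SmoothEndo 𝓘(ℝ, E) A :=
  contMDiff_hom_of_apply h

theorem isInvertible_of_nondegenerate {W : Type*} [AddCommGroup W] [Module ℝ W]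
    [TopologicalSpace W] [IsTopologicalAddGroup W] [ContinuousSMul ℝ W] [T2Space W]
    [FiniteDimensional ℝ W] {b : W →L[ℝ] W →L[ℝ] ℝ} (hb : ∀ v, (∀ u, b v u = 0) → v = 0) :
    b.IsInvertible := by
  have hinj : Function.Injective (b : W →ₗ[ℝ] W →L[ℝ] ℝ) := by
    rw [← LinearMap.ker_eq_bot, LinearMap.ker_eq_bot']
    exact fun v hv => hb v fun u => congr($hv u)
  have hrank : Module.finrank ℝ W = Module.finrank ℝ (W →L[ℝ] ℝ) := by
    rw [← (LinearMap.toContinuousLinearMap (𝕜 := ℝ) (E := W) (F' := ℝ)).finrank_eq]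
    exact (Subspace.dual_finrank_eq (K := ℝ) (V := W)).symm
  have : FiniteDimensional ℝ (W →L[ℝ] ℝ) :=
    (LinearMap.toContinuousLinearMap (𝕜 := ℝ) (E := W) (F' := ℝ)).finiteDimensional
  refine ⟨(LinearEquiv.ofBijective _ ⟨hinj, (LinearMap.injective_iff_surjective_of_finrank_eq_finrank
    hrank).1 hinj⟩).toContinuousLinearEquiv, ?_⟩
  ext v
  rfl

theorem SmoothOneForm.sharp {b : Π x : M, TangentSpace 𝓘(ℝ, E) x →L[ℝ] TangentSpace 𝓘(ℝ, E) x →L[ℝ] ℝ}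
    {α : Π x : M, TangentSpace 𝓘(ℝ, E) x →L[ℝ] ℝ} (hα : SmoothOneForm 𝓘(ℝ, E) α)
    (hb : SmoothBilin 𝓘(ℝ, E) b) (hinv : ∀ x, (b x).IsInvertible) :
    SmoothVF 𝓘(ℝ, E) (fun x => sharp (b x) (α x)) := by
  have := FiniteDimensional.complete ℝ E
  intro x
  refine ContMDiffAt.clm_bundle_apply (E₁ := fun x : M => TangentSpace 𝓘(ℝ, E) x →L[ℝ] ℝ)
    (F₁ := E →L[ℝ] ℝ) ?_ (hα x)
  have hbx := ((contMDiffAt_hom_bundle _).1 (hb x)).2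
  refine (contMDiffAt_hom_bundle _).2 ⟨contMDiffAt_id, ?_⟩
  dsimp only [TotalSpace.mk'] at hbx ⊢
  have hx := FiberBundle.mem_baseSet_trivializationAt E (TangentSpace 𝓘(ℝ, E) : M → Type _) x
  have hx' := FiberBundle.mem_baseSet_trivializationAt (E →L[ℝ] ℝ)
    (fun x : M => TangentSpace 𝓘(ℝ, E) x →L[ℝ] ℝ) x
  have h1 : (ContinuousLinearMap.inCoordinates E (TangentSpace 𝓘(ℝ, E) : M → Type _) (E →L[ℝ] ℝ)
      (fun x : M => TangentSpace 𝓘(ℝ, E) x →L[ℝ] ℝ) x x x x (b x)).IsInvertible := by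
    rw [ContinuousLinearMap.inCoordinates_eq hx hx']
    simpa using hinv x
  refine (h1.contDiffAt_map_inverse.contMDiffAt.comp x hbx).congr_of_eventuallyEq ?_
  filter_upwards [(trivializationAt E (TangentSpace 𝓘(ℝ, E)) x).open_baseSet.mem_nhds hx,
    (trivializationAt (E →L[ℝ] ℝ)
      (fun x : M => TangentSpace 𝓘(ℝ, E) x →L[ℝ] ℝ) x).open_baseSet.mem_nhds hx'] with y hy hy'
  rw [Function.comp_apply, ContinuousLinearMap.inCoordinates_eq hy hy',
    ContinuousLinearMap.inCoordinates_eq hy' hy, ParaHerm.sharp]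
  simp [ContinuousLinearMap.comp_assoc]

end Smoothness

section Leibniz

variable {G C : Type*} [LieRing G] [AddCommGroup C] [LieRingModule G C]

/-- The expression `(𝔏_X b) W - (𝔏_Y a) W + W (a Y)`, the second component of the Dorfman product
of `(X, a)` and `(Y, b)`, evaluated on `W`. -/
def dorfmanForm (X : G) (a : G → C) (Y : G) (b : G → C) (W : G) : C :=
  ⁅X, b W⁆ - b ⁅X, W⁆ - (⁅Y, a W⁆ - a ⁅Y, W⁆) + ⁅W, a Y⁆

theorem dorfmanForm_leibniz (X Y Z W : G) (a b c : G →+ C) :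
    dorfmanForm X a ⁅Y, Z⁆ (dorfmanForm Y b Z c) W
      = dorfmanForm ⁅X, Y⁆ (dorfmanForm X a Y b) Z c W
        + dorfmanForm Y b ⁅X, Z⁆ (dorfmanForm X a Z c) W := by
  simp only [dorfmanForm, lie_sub, lie_add, lie_lie, map_sub]
  abel

end Leibniz

section VectorFields

open VectorField Filter

variable {E : Type*} [NormedAddCommGroup E] [NormedSpace ℝ E] [FiniteDimensional ℝ E]
  {M : Type*} [TopologicalSpace M] [ChartedSpace E M] [IsManifold 𝓘(ℝ, E) ∞ M]

theorem mvfderiv_const_mul {f : M → ℝ} {x : M} (c : ℝ) (hf : MDifferentiableAt 𝓘(ℝ, E) 𝓘(ℝ, ℝ) f x) :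
    mvfderiv 𝓘(ℝ, E) (fun y => c * f y) x = c • mvfderiv 𝓘(ℝ, E) f x := by
  have h := mvfderiv_smul (a := fun _ => c) mdifferentiableAt_const hf
  ext v
  have h' := congr($h v)
  rw [mvfderiv_const] at h'
  exact h'.trans (by simp)

variable (E M) in
/-- The space of smooth vector fields. -/
abbrev SmoothVectorFields : Type _ :=
  Cₛ^∞⟮𝓘(ℝ, E); E, (TangentSpace 𝓘(ℝ, E) : M → Type _)⟯

/-- The Lie algebra of smooth vector fields. -/
instance : LieRing (SmoothVectorFields E M) where
  bracket X Y := ⟨mlieBracket 𝓘(ℝ, E) X Y, SmoothVF.mlieBracket X.contMDiff Y.contMDiff⟩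
  add_lie X Y Z := by
    have := FiniteDimensional.complete ℝ E
    ext x
    exact mlieBracket_add_left X.mdifferentiableAt Y.mdifferentiableAt
  lie_add X Y Z := by
    have := FiniteDimensional.complete ℝ E
    ext x
    exact mlieBracket_add_right Y.mdifferentiableAt Z.mdifferentiableAt
  lie_self X := by
    ext x
    exact congrFun mlieBracket_self x
  leibniz_lie X Y Z := by
    have := FiniteDimensional.complete ℝ E
    have : IsManifold 𝓘(ℝ, E) (minSmoothness ℝ 3) M := by simp; infer_instance
    have two_le : minSmoothness ℝ 2 ≤ (∞ : WithTop ℕ∞) := by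
      simpa using (WithTop.coe_le_coe.2 le_top : (2 : WithTop ℕ∞) ≤ ∞)
    ext x
    exact leibniz_identity_mlieBracket_apply ((X.contMDiff x).of_le two_le)
      ((Y.contMDiff x).of_le two_le) ((Z.contMDiff x).of_le two_le)

instance : LieAlgebra ℝ (SmoothVectorFields E M) where
  lie_smul c X Y := by
    have := FiniteDimensional.complete ℝ E
    ext x
    exact mlieBracket_const_smul_right Y.mdifferentiableAt

/-- Smooth vector fields act on smooth functions. -/
instance : LieRingModule (SmoothVectorFields E M)
    C^∞⟮𝓘(ℝ, E), M; 𝓘(ℝ, ℝ), ℝ⟯ where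
  bracket X f := ⟨fun x => mvfderiv 𝓘(ℝ, E) f x (X x),
    SmoothVF.contMDiff_mvfderiv X.contMDiff f.contMDiff⟩
  add_lie X Y f := by
    ext x
    exact map_add (mvfderiv 𝓘(ℝ, E) f x) (X x) (Y x)
  lie_add X f g := by
    ext x
    exact congr($(mvfderiv_add f.mdifferentiableAt g.mdifferentiableAt) (X x))
  leibniz_lie X Y f := by
    ext x
    have := mvfderiv_mlieBracket X.contMDiff Y.contMDiff (f.contMDiff x)
    exact (sub_eq_iff_eq_add.1 this.symm)

instance : LieModule ℝ (SmoothVectorFields E M)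
    C^∞⟮𝓘(ℝ, E), M; 𝓘(ℝ, ℝ), ℝ⟯ where
  smul_lie c X f := by
    ext x
    exact map_smul (mvfderiv 𝓘(ℝ, E) f x) c (X x)
  lie_smul c X f := by
    ext x
    exact congr($(mvfderiv_const_mul c f.mdifferentiableAt) (X x))

end VectorFields

section Splitting

open VectorField Filter

variable {E : Type*} [NormedAddCommGroup E] [NormedSpace ℝ E] [FiniteDimensional ℝ E]
  {M : Type*} [TopologicalSpace M] [ChartedSpace E M] [IsManifold 𝓘(ℝ, E) ∞ M]

variable (E M) in
/-- A splitting `TM = D ⊕ D'` into subbundles, Lagrangian for the almost symplectic form `w`,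
such that `D` is involutive. -/
structure LagrangianSplitting where
  /-- the projection onto `D` -/
  p : Π x : M, TangentSpace 𝓘(ℝ, E) x →L[ℝ] TangentSpace 𝓘(ℝ, E) x
  /-- the projection onto `D'` -/
  q : Π x : M, TangentSpace 𝓘(ℝ, E) x →L[ℝ] TangentSpace 𝓘(ℝ, E) x
  /-- the almost symplectic form -/
  w : Π x : M, TangentSpace 𝓘(ℝ, E) x →L[ℝ] TangentSpace 𝓘(ℝ, E) x →L[ℝ] ℝ
  /-- the metric of the associated Courant algebroid -/
  g : Π x : M, TangentSpace 𝓘(ℝ, E) x →L[ℝ] TangentSpace 𝓘(ℝ, E) x →L[ℝ] ℝ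
  /-- the involutive subbundle -/
  D : Π x : M, Submodule ℝ (TangentSpace 𝓘(ℝ, E) x)
  p_smooth : SmoothEndo 𝓘(ℝ, E) p
  q_smooth : SmoothEndo 𝓘(ℝ, E) q
  w_smooth : SmoothBilin 𝓘(ℝ, E) w
  g_smooth : SmoothBilin 𝓘(ℝ, E) g
  p_add_q : ∀ x (v : TangentSpace 𝓘(ℝ, E) x), p x v + q x v = v
  mem_D : ∀ x (v : TangentSpace 𝓘(ℝ, E) x), v ∈ D x ↔ q x v = 0
  p_mem : ∀ x (v : TangentSpace 𝓘(ℝ, E) x), p x v ∈ D x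
  w_skew : ∀ x (v u : TangentSpace 𝓘(ℝ, E) x), w x v u = -w x u v
  w_p_p : ∀ x (v u : TangentSpace 𝓘(ℝ, E) x), w x (p x v) (p x u) = 0
  w_q_q : ∀ x (v u : TangentSpace 𝓘(ℝ, E) x), w x (q x v) (q x u) = 0
  w_nondegenerate : ∀ x (v : TangentSpace 𝓘(ℝ, E) x), (∀ u, w x v u = 0) → v = 0
  g_apply : ∀ x (v u : TangentSpace 𝓘(ℝ, E) x),
    g x v u = (1 / 2) * (w x (q x v) (p x u) + w x (q x u) (p x v))
  lie_mem : ∀ X Y : Π x : M, TangentSpace 𝓘(ℝ, E) x, SmoothVF 𝓘(ℝ, E) X → SmoothVF 𝓘(ℝ, E) Y →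
    (∀ x, X x ∈ D x) → (∀ x, Y x ∈ D x) → ∀ x, mlieBracket 𝓘(ℝ, E) X Y x ∈ D x

namespace LagrangianSplitting

variable (S : LagrangianSplitting E M)

section Pointwise

variable (x : M) (v u : TangentSpace 𝓘(ℝ, E) x)

@[simp] theorem q_p : S.q x (S.p x v) = 0 := (S.mem_D x _).1 (S.p_mem x v)

theorem p_eq_self {v : TangentSpace 𝓘(ℝ, E) x} (hv : v ∈ S.D x) : S.p x v = v := by
  have h := S.p_add_q x v
  rwa [(S.mem_D x v).1 hv, add_zero] at h

@[simp] theorem p_p : S.p x (S.p x v) = S.p x v := S.p_eq_self x (S.p_mem x v)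

@[simp] theorem p_q : S.p x (S.q x v) = 0 := by
  have h := congrArg (S.p x) (S.p_add_q x v)
  rwa [map_add, p_p, add_eq_left] at h

theorem w_q_left : S.w x (S.q x v) u = S.w x v (S.p x u) := by
  conv_lhs => rw [← S.p_add_q x u, map_add, S.w_q_q, add_zero]
  conv_rhs => rw [← S.p_add_q x v, map_add, add_apply, S.w_p_p, zero_add]

theorem w_q_p : S.w x (S.q x v) (S.p x u) = S.w x v (S.p x u) := by
  rw [S.w_q_left, p_p]

theorem w_eq : S.w x v u = S.w x (S.q x v) (S.p x u) - S.w x (S.q x u) (S.p x v) := by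
  conv_lhs => rw [← S.p_add_q x v, map_add, add_apply, S.w_q_left, S.w_skew x (S.p x v)]
  rw [S.w_q_p, S.w_q_p]
  ring

theorem isInvertible_w : (S.w x).IsInvertible :=
  have : T2Space (TangentSpace 𝓘(ℝ, E) x) := inferInstanceAs (T2Space E)
  have : FiniteDimensional ℝ (TangentSpace 𝓘(ℝ, E) x) := inferInstanceAs (FiniteDimensional ℝ E)
  isInvertible_of_nondegenerate (S.w_nondegenerate x)

theorem g_symm : S.g x v u = S.g x u v := by
  rw [S.g_apply, S.g_apply, add_comm]

theorem g_nondegenerate (h : ∀ u, S.g x v u = 0) : v = 0 := by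
  have hq : S.q x v = 0 := S.w_nondegenerate x _ fun u => by
    have hu := h (S.p x u)
    rw [S.g_apply, q_p, p_p, S.w_q_p, map_zero, zero_apply, add_zero] at hu
    rw [S.w_q_left]
    linarith
  have hp : S.p x v = 0 := S.w_nondegenerate x _ fun u => by
    have hu := h u
    rw [S.g_apply, hq, S.w_q_p, map_zero, zero_apply, zero_add] at hu
    rw [S.w_skew]
    linarith
  rw [← S.p_add_q x v, hp, hq, add_zero]

theorem isInvertible_g : (S.g x).IsInvertible :=
  have : T2Space (TangentSpace 𝓘(ℝ, E) x) := inferInstanceAs (T2Space E)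
  have : FiniteDimensional ℝ (TangentSpace 𝓘(ℝ, E) x) := inferInstanceAs (FiniteDimensional ℝ E)
  isInvertible_of_nondegenerate (S.g_nondegenerate x)

theorem w_sharp (α : TangentSpace 𝓘(ℝ, E) x →L[ℝ] ℝ) : S.w x (sharp (S.w x) α) = α :=
  (S.isInvertible_w x).self_apply_inverse α

theorem sharp_w : sharp (S.w x) (S.w x v) = v :=
  (S.isInvertible_w x).inverse_apply_self v

theorem p_sharp (α : TangentSpace 𝓘(ℝ, E) x →L[ℝ] ℝ) :
    S.p x (sharp (S.w x) (α.comp (S.p x))) = 0 := by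
  have h : S.q x (sharp (S.w x) (α.comp (S.p x))) = sharp (S.w x) (α.comp (S.p x)) := by
    apply (S.isInvertible_w x).injective
    ext u
    rw [S.w_q_left, S.w_sharp]
    simp
  rw [← h, p_q]

theorem q_sharp (α : TangentSpace 𝓘(ℝ, E) x →L[ℝ] ℝ) :
    S.q x (sharp (S.w x) (α.comp (S.p x))) = sharp (S.w x) (α.comp (S.p x)) := by
  have h := S.p_add_q x (sharp (S.w x) (α.comp (S.p x)))
  rwa [S.p_sharp, zero_add] at h

theorem sharp_w_comp : sharp (S.w x) ((S.w x v).comp (S.p x)) = S.q x v := by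
  rw [← S.sharp_w x (S.q x v)]
  congr 1
  ext u
  rw [S.w_q_left]
  rfl

theorem coanchor_eq (α : TangentSpace 𝓘(ℝ, E) x →L[ℝ] ℝ) :
    coanchor 𝓘(ℝ, E) S.g S.p x α = sharp (S.w x) (α.comp (S.p x)) := by
  rw [coanchor]
  have h : α.comp (S.p x) = S.g x ((2 : ℝ) • sharp (S.w x) (α.comp (S.p x))) := by
    ext u
    rw [map_smul, smul_apply, S.g_apply, p_sharp, map_zero, add_zero, q_sharp, S.w_sharp]
    simp
  conv_lhs => rw [h]
  rw [sharp, (S.isInvertible_g x).inverse_apply_self, smul_smul]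
  norm_num

end Pointwise

/-- The projection of vector fields onto `D`. -/
def proj : SmoothVectorFields E M →ₗ[ℝ] SmoothVectorFields E M where
  toFun X := ⟨fun x => S.p x (X x), S.p_smooth.apply X.contMDiff⟩
  map_add' X Y := by ext x; exact map_add (S.p x) _ _
  map_smul' c X := by ext x; exact map_smul (S.p x) c _

@[simp] theorem proj_apply (X : SmoothVectorFields E M) (x : M) : S.proj X x = S.p x (X x) := rfl

/-- The function `w (qX, Y)`. -/
def form : SmoothVectorFields E M →ₗ[ℝ] SmoothVectorFields E M →ₗ[ℝ] C^∞⟮𝓘(ℝ, E), M; 𝓘(ℝ, ℝ), ℝ⟯ :=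
  LinearMap.mk₂ ℝ
    (fun X Y => ⟨fun x => S.w x (S.q x (X x)) (Y x),
      (S.w_smooth.apply (S.q_smooth.apply X.contMDiff)).apply Y.contMDiff⟩)
    (fun X X' Y => by ext x; simp; rfl)
    (fun c X Y => by ext x; simp; rfl)
    (fun X Y Y' => by ext x; simp; rfl)
    (fun c X Y => by ext x; simp; rfl)

theorem form_apply (X Y : SmoothVectorFields E M) (x : M) : S.form X Y x = S.w x (S.q x (X x)) (Y x) := rfl

theorem form_proj (X Y : SmoothVectorFields E M) : S.form X (S.proj Y) = S.form X Y := by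
  ext x
  rw [form_apply, form_apply, proj_apply, S.w_q_p, S.w_q_left]

theorem proj_proj (X : SmoothVectorFields E M) : S.proj (S.proj X) = S.proj X := by
  ext x
  exact S.p_p x _

theorem proj_lie (X Y : SmoothVectorFields E M) : S.proj ⁅S.proj X, S.proj Y⁆ = ⁅S.proj X, S.proj Y⁆ := by
  ext x
  exact S.p_eq_self x (S.lie_mem _ _ (S.proj X).contMDiff (S.proj Y).contMDiff
    (fun y => S.p_mem y (X y)) (fun y => S.p_mem y (Y y)) x)

theorem section_ext [T2Space M] {X Y : SmoothVectorFields E M} (hp : S.proj X = S.proj Y)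
    (hq : ∀ Z, S.form X (S.proj Z) = S.form Y (S.proj Z)) : X = Y := by
  ext x
  have h : S.q x (X x) = S.q x (Y x) := by
    apply (S.isInvertible_w x).injective
    ext u
    obtain ⟨Z, hZ, rfl⟩ := exists_smoothVF_eq x u
    have := congr($(hq ⟨Z, hZ⟩) x)
    rwa [form_proj, form_proj] at this
  have h' := congr($hp x)
  rw [proj_apply, proj_apply] at h'
  rw [← S.p_add_q x (X x), h, h', S.p_add_q]

/-- The covector field `𝔏_{pX} i(qY)w - 𝔏_{pY} i(qX)w + df`. -/
def lieCovector (X Y : Π x : M, TangentSpace 𝓘(ℝ, E) x) (f : M → ℝ) (x : M) :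
    TangentSpace 𝓘(ℝ, E) x →L[ℝ] ℝ :=
  lieOne 𝓘(ℝ, E) (fun y => S.p y (X y)) (fun y => S.w y (S.q y (Y y))) x
    - lieOne 𝓘(ℝ, E) (fun y => S.p y (Y y)) (fun y => S.w y (S.q y (X y))) x
    + mvfderiv 𝓘(ℝ, E) f x

theorem lieForm_eq (X Y : Π x : M, TangentSpace 𝓘(ℝ, E) x) (f : M → ℝ) (x : M) :
    lieForm 𝓘(ℝ, E) S.p S.q S.w X Y f x
      = mlieBracket 𝓘(ℝ, E) (fun y => S.p y (X y)) (fun y => S.p y (Y y)) x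
        + sharp (S.w x) ((S.lieCovector X Y f x).comp (S.p x)) := rfl

theorem smoothVF_sharp [T2Space M] {α : Π x : M, TangentSpace 𝓘(ℝ, E) x →L[ℝ] ℝ}
    (hα : SmoothOneForm 𝓘(ℝ, E) α) :
    SmoothVF 𝓘(ℝ, E) (fun x => sharp (S.w x) ((α x).comp (S.p x))) :=
  (hα.comp S.p_smooth).sharp S.w_smooth S.isInvertible_w

theorem smoothVF_lieForm [T2Space M] (X Y : SmoothVectorFields E M) {f : M → ℝ}
    (hf : ContMDiff 𝓘(ℝ, E) 𝓘(ℝ, ℝ) ∞ f) :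
    SmoothVF 𝓘(ℝ, E) (lieForm 𝓘(ℝ, E) S.p S.q S.w X Y f) := by
  have hX := S.p_smooth.apply X.contMDiff
  have hY := S.p_smooth.apply Y.contMDiff
  have hX' := S.w_smooth.apply (S.q_smooth.apply X.contMDiff)
  have hY' := S.w_smooth.apply (S.q_smooth.apply Y.contMDiff)
  exact ContMDiff.add_section (hX.mlieBracket hY) (S.smoothVF_sharp
    (((smoothOneForm_lieOne hX hY').sub (smoothOneForm_lieOne hY hX')).add
      (smoothOneForm_mvfderiv hf)))

/-- The Dorfman product of two vector fields. -/
def dorfmanField [T2Space M] (X Y : SmoothVectorFields E M) : SmoothVectorFields E M :=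
  ⟨lieForm 𝓘(ℝ, E) S.p S.q S.w X Y (S.form X (S.proj Y)),
    S.smoothVF_lieForm X Y (S.form X (S.proj Y)).contMDiff⟩

theorem dorfmanField_apply [T2Space M] (X Y : SmoothVectorFields E M) (x : M) : S.dorfmanField X Y x
    = lieForm 𝓘(ℝ, E) S.p S.q S.w X Y (fun y => S.w y (S.q y (X y)) (S.p y (Y y))) x := rfl

theorem p_lieForm (X Y : SmoothVectorFields E M) (f : M → ℝ) (x : M) :
    S.p x (lieForm 𝓘(ℝ, E) S.p S.q S.w X Y f x) = ⁅S.proj X, S.proj Y⁆ x := by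
  rw [lieForm_eq, map_add, p_sharp, add_zero]
  exact congr($(S.proj_lie X Y) x)

theorem w_q_lieForm (X Y : SmoothVectorFields E M) (f : M → ℝ) (x : M) (u : TangentSpace 𝓘(ℝ, E) x) :
    S.w x (S.q x (lieForm 𝓘(ℝ, E) S.p S.q S.w X Y f x)) u
      = S.lieCovector X Y f x (S.p x u) := by
  have h : S.q x (mlieBracket 𝓘(ℝ, E) (fun y => S.p y (X y)) (fun y => S.p y (Y y)) x) = 0 := by
    change S.q x (⁅S.proj X, S.proj Y⁆ x) = 0
    rw [← proj_lie, proj_apply, q_p]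
  rw [lieForm_eq, map_add, h, zero_add, q_sharp, S.w_sharp]
  rfl

theorem lieCovector_apply (X Y Z : SmoothVectorFields E M) (f : M → ℝ) (x : M) :
    S.lieCovector X Y f x (Z x)
      = (⁅S.proj X, S.form Y Z⁆ - S.form Y ⁅S.proj X, Z⁆
        - (⁅S.proj Y, S.form X Z⁆ - S.form X ⁅S.proj Y, Z⁆)) x + mvfderiv 𝓘(ℝ, E) f x (Z x) := by
  have hX' := S.w_smooth.apply (S.q_smooth.apply X.contMDiff)
  have hY' := S.w_smooth.apply (S.q_smooth.apply Y.contMDiff)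
  rw [lieCovector, add_apply, sub_apply,
    lieOne_apply hX' Z.mdifferentiableAt, lieOne_apply hY' Z.mdifferentiableAt]
  rfl

theorem proj_dorfmanField [T2Space M] (X Y : SmoothVectorFields E M) :
    S.proj (S.dorfmanField X Y) = ⁅S.proj X, S.proj Y⁆ := by
  ext x
  exact S.p_lieForm X Y _ x

theorem form_dorfmanField [T2Space M] (X Y Z : SmoothVectorFields E M) (hZ : S.proj Z = Z) :
    S.form (S.dorfmanField X Y) Z
      = dorfmanForm (S.proj X) (S.form X) (S.proj Y) (S.form Y) Z := by
  ext x
  have hZx : S.p x (Z x) = Z x := congr($hZ x)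
  rw [form_apply, dorfmanField_apply, w_q_lieForm, hZx, lieCovector_apply]
  rfl

theorem form_dorfmanField_proj [T2Space M] (X Y Z : SmoothVectorFields E M) :
    S.form (S.dorfmanField X Y) (S.proj Z)
      = dorfmanForm (S.proj X) (S.form X) (S.proj Y) (S.form Y) (S.proj Z) :=
  S.form_dorfmanField X Y _ (S.proj_proj Z)

/-- The Dorfman product, as a bilinear map. -/
def dorfman [T2Space M] : SmoothVectorFields E M →ₗ[ℝ] SmoothVectorFields E M →ₗ[ℝ] SmoothVectorFields E M := by
  refine LinearMap.mk₂ ℝ S.dorfmanField (fun X X' Y => ?_) (fun c X Y => ?_) (fun X Y Y' => ?_)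
    (fun c X Y => ?_) <;>
  refine S.section_ext ?_ fun Z => ?_ <;>
  simp only [proj_dorfmanField, map_add, map_smul, add_lie, lie_add, smul_lie, lie_smul,
    LinearMap.add_apply, LinearMap.smul_apply, form_dorfmanField_proj,
    dorfmanForm] <;>
  module

@[simp] theorem dorfman_apply [T2Space M] (X Y : SmoothVectorFields E M) : S.dorfman X Y = S.dorfmanField X Y := rfl

theorem dorfman_leibniz [T2Space M] (X Y Z : SmoothVectorFields E M) :
    S.dorfman X (S.dorfman Y Z) = S.dorfman (S.dorfman X Y) Z + S.dorfman Y (S.dorfman X Z) := by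
  refine S.section_ext ?_ fun W => ?_
  · simp only [dorfman_apply, map_add, proj_dorfmanField]
    exact leibniz_lie _ _ _
  · have key := dorfmanForm_leibniz (S.proj X) (S.proj Y) (S.proj Z) (S.proj W)
      (S.form X).toAddMonoidHom (S.form Y).toAddMonoidHom (S.form Z).toAddMonoidHom
    simp only [dorfman_apply, map_add, LinearMap.add_apply, form_dorfmanField_proj,
      proj_dorfmanField]
    simp only [dorfmanForm, form_dorfmanField_proj,
      S.form_dorfmanField _ _ _ (S.proj_lie _ _)] at key ⊢
    exact key

/-- The metric as a function of two vector fields. -/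
def inner (X Y : SmoothVectorFields E M) : C^∞⟮𝓘(ℝ, E), M; 𝓘(ℝ, ℝ), ℝ⟯ :=
  ⟨fun x => S.g x (X x) (Y x), (S.g_smooth.apply X.contMDiff).apply Y.contMDiff⟩

theorem inner_eq (X Y : SmoothVectorFields E M) :
    S.inner X Y = (1 / 2 : ℝ) • (S.form X (S.proj Y) + S.form Y (S.proj X)) := by
  ext x
  exact S.g_apply x _ _

theorem dorfman_compatible [T2Space M] (X Y Z : SmoothVectorFields E M) :
    ⁅S.proj X, S.inner Y Z⁆ = S.inner (S.dorfman X Y) Z + S.inner Y (S.dorfman X Z) := by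
  simp only [inner_eq, dorfman_apply, proj_dorfmanField, lie_smul, lie_add,
    form_dorfmanField_proj, dorfmanForm]
  rw [← lie_skew (S.proj Z) (S.proj Y), map_neg]
  module

variable [T2Space M]

/-- The Courant algebroid structure on `TM` defined by a Lagrangian splitting. -/
def courantAlgebroid : CourantAlgebroid 𝓘(ℝ, E) E (TangentSpace 𝓘(ℝ, E) : M → Type _) where
  metric := S.g
  metric_smooth := S.g_smooth
  metric_symm := S.g_symm
  metric_nondegenerate := S.g_nondegenerate
  anchor := S.p
  anchor_smooth := S.p_smooth
  dorfman := S.dorfman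
  compatibility X Y Z x := congr($(S.dorfman_compatible X Y Z) x)
  normalization X x := by
    rw [coanchor_eq, dorfman_apply, dorfmanField_apply, lieForm, mlieBracket_self, sub_self,
      zero_add]
    have h : (fun y => S.g y (X y) (X y)) = fun y => S.w y (S.q y (X y)) (S.p y (X y)) := by
      funext y
      rw [S.g_apply]
      ring
    rw [h]
    simp
  leibniz := S.dorfman_leibniz

end LagrangianSplitting

end Splitting

section Transfer

open VectorField Filter

variable {E : Type*} [NormedAddCommGroup E] [NormedSpace ℝ E] [FiniteDimensional ℝ E]
  {M : Type*} [TopologicalSpace M] [ChartedSpace E M] [IsManifold 𝓘(ℝ, E) ∞ M]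

theorem cls_eq_cls {D : Π x : M, Submodule ℝ (TangentSpace 𝓘(ℝ, E) x)} {x : M}
    {α β : TangentSpace 𝓘(ℝ, E) x →L[ℝ] ℝ} :
    cls 𝓘(ℝ, E) D x α = cls 𝓘(ℝ, E) D x β ↔ ∀ v ∈ D x, α v = β v := by
  rw [cls, Submodule.mkQ_apply, Submodule.mkQ_apply, Submodule.Quotient.eq]
  exact forall₂_congr fun v _ => sub_eq_zero

namespace LagrangianSplitting

variable (S : LagrangianSplitting E M)

/-- The identification `X ↦ (pX, [i(qX)w])` of `TM` with the big tangent bundle of `D`. -/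
def toBig (x : M) : TangentSpace 𝓘(ℝ, E) x →ₗ[ℝ] BigTangent 𝓘(ℝ, E) S.D x :=
  ((S.p x : TangentSpace 𝓘(ℝ, E) x →ₗ[ℝ] TangentSpace 𝓘(ℝ, E) x).codRestrict (S.D x)
    (S.p_mem x)).prod
    ((cls 𝓘(ℝ, E) S.D x).comp ((S.w x).comp (S.q x) :
      TangentSpace 𝓘(ℝ, E) x →ₗ[ℝ] (TangentSpace 𝓘(ℝ, E) x →L[ℝ] ℝ)))

theorem toBig_fst (x : M) (v : TangentSpace 𝓘(ℝ, E) x) :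
    ((S.toBig x v).1 : TangentSpace 𝓘(ℝ, E) x) = S.p x v := rfl

theorem toBig_snd (x : M) (v : TangentSpace 𝓘(ℝ, E) x) :
    (S.toBig x v).2 = cls 𝓘(ℝ, E) S.D x (S.w x (S.q x v)) := rfl

theorem toBig_add_sharp {x : M} (Y : S.D x) (α : TangentSpace 𝓘(ℝ, E) x →L[ℝ] ℝ) :
    S.toBig x (Y + sharp (S.w x) (α.comp (S.p x))) = (Y, cls 𝓘(ℝ, E) S.D x α) := by
  refine Prod.ext (Subtype.ext ?_) ?_
  · rw [toBig_fst, map_add, p_sharp, add_zero, S.p_eq_self x Y.2]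
  · rw [toBig_snd, map_add, (S.mem_D x _).1 Y.2, zero_add, q_sharp, w_sharp, cls_eq_cls]
    exact fun v hv => congrArg α (S.p_eq_self x hv)

theorem toBig_bijective (x : M) : Function.Bijective (S.toBig x) := by
  refine ⟨(injective_iff_map_eq_zero _).2 fun v hv => ?_, fun s => ?_⟩
  · have h1 : S.p x v = 0 := congrArg (fun s => ((s.1 : S.D x) : TangentSpace 𝓘(ℝ, E) x)) hv
    have h2 : S.q x v = 0 := by
      have h := congrArg Prod.snd hv
      rw [toBig_snd, Prod.snd_zero, ← map_zero (cls 𝓘(ℝ, E) S.D x), cls_eq_cls] at h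
      refine S.w_nondegenerate x _ fun u => ?_
      rw [S.w_q_left, ← S.w_q_p]
      exact h _ (S.p_mem x u)
    rw [← S.p_add_q x v, h1, h2, add_zero]
  · obtain ⟨α, hα⟩ := Submodule.mkQ_surjective _ s.2
    exact ⟨_, (S.toBig_add_sharp s.1 α).trans (Prod.ext rfl hα)⟩

theorem smoothBig_toBig {X : Π x : M, TangentSpace 𝓘(ℝ, E) x} (hX : SmoothVF 𝓘(ℝ, E) X) :
    SmoothBig 𝓘(ℝ, E) S.D (fun x => S.toBig x (X x)) :=
  ⟨S.p_smooth.apply hX, fun x => S.w x (S.q x (X x)),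
    S.w_smooth.apply (S.q_smooth.apply hX), fun _ => rfl⟩

variable [T2Space M]

theorem smoothVF_of_smoothBig {X : Π x : M, TangentSpace 𝓘(ℝ, E) x}
    (hX : SmoothBig 𝓘(ℝ, E) S.D (fun x => S.toBig x (X x))) : SmoothVF 𝓘(ℝ, E) X := by
  obtain ⟨hp, α, hα, h⟩ := hX
  have hq : (fun x => S.q x (X x)) = fun x => sharp (S.w x) ((α x).comp (S.p x)) := by
    funext x
    rw [← S.sharp_w x (S.q x (X x))]
    congr 1
    ext u
    rw [S.w_q_left, ← S.w_q_p]
    exact (cls_eq_cls.1 (h x) _ (S.p_mem x u)).symm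
  have hX : X = (fun x => S.p x (X x)) + fun x => sharp (S.w x) ((α x).comp (S.p x)) := by
    rw [← hq]
    funext x
    exact (S.p_add_q x (X x)).symm
  rw [hX]
  exact ContMDiff.add_section hp (S.smoothVF_sharp hα)

theorem metric_eq_bigMetric (x : M) (v u : TangentSpace 𝓘(ℝ, E) x) :
    S.g x v u = bigMetric 𝓘(ℝ, E) S.D x (S.toBig x v) (S.toBig x u) := S.g_apply x v u

theorem del_eq (f : M → ℝ) (x : M) :
    S.courantAlgebroid.del f x = sharp (S.w x) ((mvfderiv 𝓘(ℝ, E) f x).comp (S.p x)) :=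
  S.coanchor_eq x _

theorem toBig_del (f : M → ℝ) (x : M) :
    S.toBig x (S.courantAlgebroid.del f x) = bigDel 𝓘(ℝ, E) S.D f x := by
  have h := S.toBig_add_sharp (0 : S.D x) (mvfderiv 𝓘(ℝ, E) f x)
  rwa [Submodule.coe_zero, zero_add, ← del_eq] at h

theorem bracket_eq (X Y : SmoothVectorFields E M) (x : M) :
    S.courantAlgebroid.bracket X Y x
      = lieForm 𝓘(ℝ, E) S.p S.q S.w X Y (fun y => (1 / 2) * S.w y (X y) (Y y)) x := by
  have hd : mvfderiv 𝓘(ℝ, E) (fun y => (1 / 2) * S.w y (X y) (Y y)) x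
      = mvfderiv 𝓘(ℝ, E) (fun y => S.w y (S.q y (X y)) (S.p y (Y y))) x
        - mvfderiv 𝓘(ℝ, E) (fun y => S.g y (X y) (Y y)) x := by
    have h := mvfderiv_sub ((S.form X (S.proj Y)).mdifferentiableAt (x := x))
      ((S.inner X Y).mdifferentiableAt (x := x))
    refine Eq.trans ?_ h
    congr 1
    funext y
    have h1 : (S.form X (S.proj Y) y : ℝ) = S.w y (S.q y (X y)) (S.p y (Y y)) := rfl
    have h2 : (S.inner X Y y : ℝ) = S.g y (X y) (Y y) := rfl
    rw [Pi.sub_apply, h1, h2, S.g_apply, S.w_eq]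
    ring
  change S.dorfmanField X Y x - S.courantAlgebroid.del (fun y => S.g y (X y) (Y y)) x = _
  rw [dorfmanField_apply, lieForm_eq, lieForm_eq, del_eq, add_sub_assoc, ← map_sub,
    ← ContinuousLinearMap.sub_comp, lieCovector, lieCovector, hd, add_sub_assoc]

theorem smoothVF_bracket (X Y : SmoothVectorFields E M) : SmoothVF 𝓘(ℝ, E) (S.courantAlgebroid.bracket X Y) := by
  rw [show S.courantAlgebroid.bracket X Y = _ from funext (S.bracket_eq X Y)]
  exact S.smoothVF_lieForm X Y
    (contMDiff_const.mul ((S.w_smooth.apply X.contMDiff).apply Y.contMDiff))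

theorem isBigBracket (X Y : SmoothVectorFields E M) : IsBigBracket 𝓘(ℝ, E) S.D (fun x => S.toBig x (X x))
    (fun x => S.toBig x (Y x)) (fun x => S.toBig x (S.courantAlgebroid.bracket X Y x)) := by
  refine ⟨S.smoothBig_toBig X.contMDiff, S.smoothBig_toBig Y.contMDiff,
    S.smoothBig_toBig (S.smoothVF_bracket X Y), fun α β hα hβ x => ⟨?_, ?_⟩⟩
  · rw [toBig_fst, bracket_eq, p_lieForm]
    rfl
  · rw [toBig_snd, cls_eq_cls, bracket_eq]
    intro v hv
    obtain ⟨Z, hZ, rfl⟩ := exists_smoothVF_eq x v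
    have hα' : ∀ y, ∀ u ∈ S.D y, α y u = S.w y (S.q y (X y)) u := fun y => cls_eq_cls.1 (hα.2 y)
    have hβ' : ∀ y, ∀ u ∈ S.D y, β y u = S.w y (S.q y (Y y)) u := fun y => cls_eq_cls.1 (hβ.2 y)
    let Z' : SmoothVectorFields E M := S.proj ⟨Z, hZ⟩
    have hZ' : S.p x (Z x) = Z' x := rfl
    have hmem : ∀ y, Z' y ∈ S.D y := fun y => S.p_mem y _
    have hlie : ∀ W : SmoothVectorFields E M, mlieBracket 𝓘(ℝ, E) (S.proj W) Z' x ∈ S.D x := fun W =>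
      S.lie_mem _ _ (S.proj W).contMDiff Z'.contMDiff (fun y => S.p_mem y _) hmem x
    have hfun : (fun y => α y ((S.toBig y (Y y)).1) - β y ((S.toBig y (X y)).1))
        = fun y => S.w y (X y) (Y y) := by
      funext y
      rw [hα' y _ (S.toBig y (Y y)).1.2, hβ' y _ (S.toBig y (X y)).1.2]
      exact (S.w_eq y (X y) (Y y)).symm
    have hsmul := mvfderiv_const_mul (1 / 2 : ℝ)
      (((S.w_smooth.apply X.contMDiff).apply Y.contMDiff x).mdifferentiableAt (by simp))
    have hβX : lieOne 𝓘(ℝ, E) (S.proj X) β x (Z' x)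
        = (⁅S.proj X, S.form Y Z'⁆ - S.form Y ⁅S.proj X, Z'⁆) x := by
      rw [lieOne_apply hβ.1 Z'.mdifferentiableAt, hβ' x _ (hlie X),
        funext fun y => hβ' y _ (hmem y)]
      rfl
    have hαY : lieOne 𝓘(ℝ, E) (S.proj Y) α x (Z' x)
        = (⁅S.proj Y, S.form X Z'⁆ - S.form X ⁅S.proj Y, Z'⁆) x := by
      rw [lieOne_apply hα.1 Z'.mdifferentiableAt, hα' x _ (hlie Y),
        funext fun y => hα' y _ (hmem y)]
      rfl
    rw [w_q_lieForm, ← S.p_eq_self x hv, p_p, hZ', lieCovector_apply, hfun, hsmul]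
    exact congrArg₂ (· + ·) (congrArg₂ (· - ·) hβX.symm hαY.symm) rfl

theorem isTransfer : IsTransfer 𝓘(ℝ, E) S.D S.courantAlgebroid S.toBig where
  bijective := S.toBig_bijective
  smooth_iff _ := ⟨S.smoothBig_toBig, S.smoothVF_of_smoothBig⟩
  anchor _ _ := rfl
  metric := S.metric_eq_bigMetric
  del f _ := S.toBig_del f
  bracket := S.isBigBracket
  dorfman X Y := by
    have h := S.isBigBracket X Y
    unfold IsBigDorfman
    convert h using 2 with x
    rw [CourantAlgebroid.bracket, map_sub, toBig_del]
    congr 2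
    funext y
    exact (S.metric_eq_bigMetric y _ _).symm

theorem lieOne_contraction {V W : Π x : M, TangentSpace 𝓘(ℝ, E) x} (hW : SmoothVF 𝓘(ℝ, E) W)
    (x : M) : lieOne 𝓘(ℝ, E) V (fun y => S.w y (W y)) x
      = lieTwo 𝓘(ℝ, E) V S.w x (W x) + S.w x (mlieBracket 𝓘(ℝ, E) V W x) := by
  ext u
  obtain ⟨Z, hZ, rfl⟩ := exists_smoothVF_eq x u
  rw [lieOne_apply (S.w_smooth.apply hW) (hZ.mdifferentiableAt x), add_apply,
    lieTwo_apply S.w_smooth (hW.mdifferentiableAt x) (hZ.mdifferentiableAt x)]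
  ring

theorem lieForm_eq_contractedForm (X Y : SmoothVectorFields E M) (f : M → ℝ) (x : M) :
    lieForm 𝓘(ℝ, E) S.p S.q S.w X Y f x = contractedForm 𝓘(ℝ, E) S.p S.q S.w X Y f x := by
  have hX := S.q_smooth.apply X.contMDiff
  have hY := S.q_smooth.apply Y.contMDiff
  rw [lieForm, contractedForm, S.lieOne_contraction hX, S.lieOne_contraction hY,
    mlieBracket_swap_apply (V := fun y => S.q y (X y)), ← sub_eq_add_neg, add_assoc,
    ← S.sharp_w_comp x (_ - _), ← map_add, ← ContinuousLinearMap.add_comp, map_sub]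
  congr 3
  abel

end LagrangianSplitting

end Transfer

section Opposite

variable {E : Type*} [NormedAddCommGroup E] [NormedSpace ℝ E] [FiniteDimensional ℝ E]
  {M : Type*} [TopologicalSpace M] [ChartedSpace E M] [IsManifold 𝓘(ℝ, E) ∞ M]
  {p q : Π x : M, TangentSpace 𝓘(ℝ, E) x →L[ℝ] TangentSpace 𝓘(ℝ, E) x}
  {w : Π x : M, TangentSpace 𝓘(ℝ, E) x →L[ℝ] TangentSpace 𝓘(ℝ, E) x →L[ℝ] ℝ}
  {α : Π x : M, TangentSpace 𝓘(ℝ, E) x →L[ℝ] ℝ}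

theorem sharp_neg {W : Type*} [AddCommGroup W] [Module ℝ W] [TopologicalSpace W]
    [IsTopologicalAddGroup W] [ContinuousSMul ℝ W] {b : W →L[ℝ] W →L[ℝ] ℝ}
    (hb : b.IsInvertible) (α : W →L[ℝ] ℝ) : sharp (-b) α = -sharp b α := by
  obtain ⟨e, rfl⟩ := hb
  rw [show -(e : W →L[ℝ] W →L[ℝ] ℝ) = (((ContinuousLinearEquiv.neg ℝ).trans e :
    W ≃L[ℝ] W →L[ℝ] ℝ) : W →L[ℝ] W →L[ℝ] ℝ) by ext; simp, sharp, sharp,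
    ContinuousLinearMap.inverse_equiv, ContinuousLinearMap.inverse_equiv]
  apply e.injective
  simp

theorem lieOne_neg [T2Space M] (X : Π x : M, TangentSpace 𝓘(ℝ, E) x)
    (hα : SmoothOneForm 𝓘(ℝ, E) α) (x : M) :
    lieOne 𝓘(ℝ, E) X (fun y => -α y) x = -lieOne 𝓘(ℝ, E) X α x := by
  ext u
  obtain ⟨Z, hZ, rfl⟩ := exists_smoothVF_eq x u
  rw [lieOne_apply hα.neg (hZ.mdifferentiableAt x)]
  simp only [neg_apply, mvfderiv_fun_neg]
  rw [lieOne_apply hα (hZ.mdifferentiableAt x)]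
  ring

theorem lieTwo_neg [T2Space M] (X : Π x : M, TangentSpace 𝓘(ℝ, E) x)
    (hw : SmoothBilin 𝓘(ℝ, E) w) (x : M) :
    lieTwo 𝓘(ℝ, E) X (fun y => -w y) x = -lieTwo 𝓘(ℝ, E) X w x := by
  ext u v
  obtain ⟨Y, hY, rfl⟩ := exists_smoothVF_eq x u
  obtain ⟨Z, hZ, rfl⟩ := exists_smoothVF_eq x v
  rw [lieTwo_apply hw.neg (hY.mdifferentiableAt x) (hZ.mdifferentiableAt x)]
  simp only [neg_apply, mvfderiv_fun_neg]
  rw [lieTwo_apply hw (hY.mdifferentiableAt x) (hZ.mdifferentiableAt x)]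
  ring

theorem lieForm_neg [T2Space M] (hq : SmoothEndo 𝓘(ℝ, E) q) (hw : SmoothBilin 𝓘(ℝ, E) w)
    (hinv : ∀ x, (w x).IsInvertible) (X Y : SmoothVectorFields E M) (f : M → ℝ) (x : M) :
    lieForm 𝓘(ℝ, E) p q (fun y => -w y) X Y (fun y => -f y) x
      = lieForm 𝓘(ℝ, E) p q w X Y f x := by
  have hX := hw.apply (hq.apply X.contMDiff)
  have hY := hw.apply (hq.apply Y.contMDiff)
  simp only [lieForm, neg_apply]
  rw [sharp_neg (hinv x), ← map_neg (sharp (w x)), lieOne_neg _ hX, lieOne_neg _ hY, mvfderiv_fun_neg,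
    ← ContinuousLinearMap.neg_comp]
  congr 3
  abel

theorem contractedForm_neg [T2Space M] (hw : SmoothBilin 𝓘(ℝ, E) w)
    (hinv : ∀ x, (w x).IsInvertible) (X Y : SmoothVectorFields E M) (f : M → ℝ) (x : M) :
    contractedForm 𝓘(ℝ, E) p q (fun y => -w y) X Y (fun y => -f y) x
      = contractedForm 𝓘(ℝ, E) p q w X Y f x := by
  simp only [contractedForm]
  rw [sharp_neg (hinv x), ← map_neg (sharp (w x)), lieTwo_neg _ hw, lieTwo_neg _ hw, mvfderiv_fun_neg,
    ← ContinuousLinearMap.neg_comp]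
  simp only [neg_apply]
  congr 3
  abel

end Opposite

namespace ParaHermitian

variable {E : Type*} [NormedAddCommGroup E] [NormedSpace ℝ E] [FiniteDimensional ℝ E]
  {M : Type*} [TopologicalSpace M] [ChartedSpace E M] [IsManifold 𝓘(ℝ, E) ∞ M]
  (P : ParaHermitian 𝓘(ℝ, E) M)

section Pointwise

variable (x : M) (v u : TangentSpace 𝓘(ℝ, E) x)

theorem prL_apply : P.prL x v = (1 / 2 : ℝ) • (v + P.F x v) := rfl

theorem prLbar_apply : P.prLbar x v = (1 / 2 : ℝ) • (v - P.F x v) := rfl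

theorem F_prL : P.F x (P.prL x v) = P.prL x v := by
  rw [prL_apply, map_smul, map_add, P.F_sq, add_comm]

theorem F_prLbar : P.F x (P.prLbar x v) = -P.prLbar x v := by
  rw [prLbar_apply, map_smul, map_sub, P.F_sq, ← smul_neg, neg_sub]

theorem mem_L_iff : v ∈ P.L x ↔ P.prLbar x v = 0 := by
  rw [L, Module.End.mem_eigenspace_iff, one_smul, prLbar_apply,
    smul_eq_zero_iff_right (by norm_num), sub_eq_zero, eq_comm]
  rfl

theorem mem_Lbar_iff : v ∈ P.Lbar x ↔ P.prL x v = 0 := by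
  rw [Lbar, Module.End.mem_eigenspace_iff, neg_smul, one_smul, prL_apply,
    smul_eq_zero_iff_right (by norm_num), add_comm, ← eq_neg_iff_add_eq_zero]
  rfl

theorem omega_skew : P.omega x v u = -P.omega x u v := by
  rw [omega_apply, omega_apply, P.γ_symm x u, P.compatible, neg_neg]

theorem γ_prL_prL : P.γ x (P.prL x v) (P.prL x u) = 0 := by
  have h := P.compatible x (P.prL x v) (P.prL x u)
  rw [F_prL, F_prL] at h
  linarith

theorem γ_prLbar_prLbar : P.γ x (P.prLbar x v) (P.prLbar x u) = 0 := by
  have h := P.compatible x (P.prLbar x v) (P.prLbar x u)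
  rw [F_prLbar, F_prLbar, map_neg, map_neg, neg_apply] at h
  linarith

theorem omega_prL_prL : P.omega x (P.prL x v) (P.prL x u) = 0 := by
  rw [omega_apply, F_prL, γ_prL_prL]

theorem omega_prLbar_prLbar : P.omega x (P.prLbar x v) (P.prLbar x u) = 0 := by
  rw [omega_apply, F_prLbar, map_neg, γ_prLbar_prLbar, neg_zero]

theorem omega_nondegenerate (h : ∀ u, P.omega x v u = 0) : v = 0 :=
  P.γ_nondegenerate x v fun u => by
    have hu := h (P.F x u)
    rwa [omega_apply, P.F_sq] at hu

theorem γ_eq_omega :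
    P.γ x v u = P.omega x (P.prLbar x v) (P.prL x u) + P.omega x (P.prLbar x u) (P.prL x v) := by
  rw [omega_apply, omega_apply, F_prL, F_prL, P.γ_symm x (P.prLbar x u)]
  conv_lhs => rw [← P.prL_add_prLbar x v, ← P.prL_add_prLbar x u]
  simp only [map_add, add_apply]
  rw [γ_prL_prL, γ_prLbar_prLbar]
  ring

theorem comp_prL_of_mem_ann {α : TangentSpace 𝓘(ℝ, E) x →L[ℝ] ℝ}
    (hα : α ∈ ann 𝓘(ℝ, E) P.Lbar x) : α.comp (P.prL x) = α := by
  ext u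
  conv_rhs => rw [← P.prL_add_prLbar x u, map_add, hα _ (P.prLbar_mem x u), add_zero]
  rfl

theorem comp_prLbar_of_mem_ann {α : TangentSpace 𝓘(ℝ, E) x →L[ℝ] ℝ}
    (hα : α ∈ ann 𝓘(ℝ, E) P.L x) : α.comp (P.prLbar x) = α := by
  ext u
  conv_rhs => rw [← P.prL_add_prLbar x u, map_add, hα _ (P.prL_mem x u), zero_add]
  rfl

end Pointwise

variable [T2Space M]

theorem smoothEndo_prL : SmoothEndo 𝓘(ℝ, E) P.prL :=
  smoothEndo_of_apply fun _ hV =>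
    ContMDiff.const_smul_section (ContMDiff.add_section hV (P.F_smooth.apply hV))

theorem smoothEndo_prLbar : SmoothEndo 𝓘(ℝ, E) P.prLbar :=
  smoothEndo_of_apply fun _ hV =>
    ContMDiff.const_smul_section (ContMDiff.sub_section hV (P.F_smooth.apply hV))

theorem smoothBilin_omega : SmoothBilin 𝓘(ℝ, E) P.omega :=
  smoothBilin_of_apply fun _ hV => (P.γ_smooth.apply hV).comp P.F_smooth

theorem smoothBilin_half_γ : SmoothBilin 𝓘(ℝ, E) (fun x => (1 / 2 : ℝ) • P.γ x) :=
  smoothBilin_of_apply fun _ hV => (P.γ_smooth.apply hV).const_smul _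

/-- The splitting `TM = L ⊕ L̄`, with the form `ω`. -/
def splitting : LagrangianSplitting E M where
  p := P.prL
  q := P.prLbar
  w := P.omega
  g x := (1 / 2 : ℝ) • P.γ x
  D := P.L
  p_smooth := P.smoothEndo_prL
  q_smooth := P.smoothEndo_prLbar
  w_smooth := P.smoothBilin_omega
  g_smooth := P.smoothBilin_half_γ
  p_add_q := P.prL_add_prLbar
  mem_D := P.mem_L_iff
  p_mem := P.prL_mem
  w_skew := P.omega_skew
  w_p_p := P.omega_prL_prL
  w_q_q := P.omega_prLbar_prLbar
  w_nondegenerate := P.omega_nondegenerate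
  g_apply x v u := congrArg ((1 / 2 : ℝ) * ·) (P.γ_eq_omega x v u)
  lie_mem _ _ hX hY hXD hYD := P.integrable_plus.mlieBracket_mem hX hY hXD hYD

/-- The splitting `TM = L̄ ⊕ L`, with the form `-ω`. -/
def oppositeSplitting : LagrangianSplitting E M where
  p := P.prLbar
  q := P.prL
  w x := -P.omega x
  g x := (1 / 2 : ℝ) • P.γ x
  D := P.Lbar
  p_smooth := P.smoothEndo_prLbar
  q_smooth := P.smoothEndo_prL
  w_smooth := P.smoothBilin_omega.neg
  g_smooth := P.smoothBilin_half_γ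
  p_add_q x v := (add_comm _ _).trans (P.prL_add_prLbar x v)
  mem_D := P.mem_Lbar_iff
  p_mem := P.prLbar_mem
  w_skew x v u := congrArg Neg.neg (P.omega_skew x v u)
  w_p_p x v u := neg_eq_zero.2 (P.omega_prLbar_prLbar x v u)
  w_q_q x v u := neg_eq_zero.2 (P.omega_prL_prL x v u)
  w_nondegenerate x v h := P.omega_nondegenerate x v fun u => neg_eq_zero.1 (h u)
  g_apply x v u := by
    change (1 / 2) * P.γ x v u
      = (1 / 2) * (-P.omega x (P.prL x v) (P.prLbar x u) + -P.omega x (P.prL x u) (P.prLbar x v))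
    rw [γ_eq_omega, ← P.omega_skew, ← P.omega_skew, add_comm]
  lie_mem _ _ hX hY hXD hYD := P.integrable_minus.mlieBracket_mem hX hY hXD hYD

theorem isInvertible_omega (x : M) : (P.omega x).IsInvertible := P.splitting.isInvertible_w x

theorem toBigL_add_sharp {x : M} (Y : P.L x) {α : TangentSpace 𝓘(ℝ, E) x →L[ℝ] ℝ}
    (hα : α ∈ ann 𝓘(ℝ, E) P.Lbar x) :
    P.toBigL x (Y + sharp (P.omega x) α) = (Y, cls 𝓘(ℝ, E) P.L x α) := by
  have h := P.splitting.toBig_add_sharp Y α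
  change P.toBigL x (Y + sharp (P.omega x) (α.comp (P.prL x))) = _ at h
  rwa [P.comp_prL_of_mem_ann x hα] at h

theorem sharp_oppositeSplitting_w (x : M) (α : TangentSpace 𝓘(ℝ, E) x →L[ℝ] ℝ) :
    sharp (P.oppositeSplitting.w x) α = -sharp (P.omega x) α :=
  sharp_neg (P.isInvertible_omega x) α

theorem toBigLbar_sub_sharp {x : M} (Y : P.Lbar x) {α : TangentSpace 𝓘(ℝ, E) x →L[ℝ] ℝ}
    (hα : α ∈ ann 𝓘(ℝ, E) P.L x) :
    P.toBigLbar x (Y - sharp (P.omega x) α) = (Y, cls 𝓘(ℝ, E) P.Lbar x α) := by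
  have h := P.oppositeSplitting.toBig_add_sharp Y α
  change P.toBigLbar x (Y + sharp (P.oppositeSplitting.w x) (α.comp (P.prLbar x))) = _ at h
  rwa [P.comp_prLbar_of_mem_ann x hα, sharp_oppositeSplitting_w, ← sub_eq_add_neg] at h

theorem oppositeSplitting_del (f : M → ℝ) (x : M) :
    P.oppositeSplitting.courantAlgebroid.del f x
      = -sharp (P.omega x) ((mvfderiv 𝓘(ℝ, E) f x).comp (P.prLbar x)) :=
  (P.oppositeSplitting.del_eq f x).trans (P.sharp_oppositeSplitting_w x _)

theorem oppositeSplitting_lieForm (X Y : SmoothVectorFields E M) (f : M → ℝ) (x : M) :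
    lieForm 𝓘(ℝ, E) P.oppositeSplitting.p P.oppositeSplitting.q P.oppositeSplitting.w X Y
        (fun y => -f y) x = lieForm 𝓘(ℝ, E) P.prLbar P.prL P.omega X Y f x :=
  lieForm_neg P.smoothEndo_prL P.smoothBilin_omega P.isInvertible_omega X Y f x

theorem lieForm_eq_contractedForm (X Y : SmoothVectorFields E M) (f : M → ℝ) (x : M) :
    lieForm 𝓘(ℝ, E) P.prL P.prLbar P.omega X Y f x
      = contractedForm 𝓘(ℝ, E) P.prL P.prLbar P.omega X Y f x :=
  P.splitting.lieForm_eq_contractedForm X Y f x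

theorem opposite_lieForm_eq_contractedForm (X Y : SmoothVectorFields E M) (f : M → ℝ) (x : M) :
    lieForm 𝓘(ℝ, E) P.prLbar P.prL P.omega X Y f x
      = contractedForm 𝓘(ℝ, E) P.prLbar P.prL P.omega X Y f x := by
  rw [← oppositeSplitting_lieForm]
  exact (P.oppositeSplitting.lieForm_eq_contractedForm X Y _ x).trans
    (contractedForm_neg P.smoothBilin_omega P.isInvertible_omega X Y f x)

theorem oppositeSplitting_bracket (X Y : SmoothVectorFields E M) (x : M) :
    P.oppositeSplitting.courantAlgebroid.bracket X Y x
      = lieForm 𝓘(ℝ, E) P.prLbar P.prL P.omega X Y (fun y => (1 / 2) * P.omega y (X y) (Y y)) x := by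
  rw [P.oppositeSplitting.bracket_eq, ← oppositeSplitting_lieForm]
  congr 1
  funext y
  exact mul_neg _ _

theorem oppositeSplitting_dorfman (X Y : SmoothVectorFields E M) (x : M) :
    P.oppositeSplitting.courantAlgebroid.dorfman X Y x
      = lieForm 𝓘(ℝ, E) P.prLbar P.prL P.omega X Y
        (fun y => P.omega y (P.prL y (X y)) (P.prLbar y (Y y))) x :=
  P.oppositeSplitting_lieForm X Y _ x

end ParaHermitian

end ParaHerm

end

theorem proposition3p1 {E : Type*} [NormedAddCommGroup E] [NormedSpace ℝ E]
    [FiniteDimensional ℝ E] {M : Type*} [TopologicalSpace M] [T2Space M] [ChartedSpace E M]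
    [IsManifold 𝓘(ℝ, E) ∞ M] (P : ParaHerm.ParaHermitian 𝓘(ℝ, E) M) :
    ∃ A B : ParaHerm.CourantAlgebroid 𝓘(ℝ, E) E (TangentSpace 𝓘(ℝ, E) : M → Type _),
      -- the structure of the foliation `L`
      (ParaHerm.IsTransfer 𝓘(ℝ, E) P.L A P.toBigL ∧
        (∀ (x : M) (Y : P.L x), ∀ α ∈ ParaHerm.ann 𝓘(ℝ, E) P.Lbar x,
          P.toBigL x ((Y : TangentSpace 𝓘(ℝ, E) x) + ParaHerm.sharp (P.omega x) α)
            = (Y, ParaHerm.cls 𝓘(ℝ, E) P.L x α)) ∧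
        A.anchor = P.prL ∧
        (∀ (x : M) (v w : TangentSpace 𝓘(ℝ, E) x),
          A.metric x v w = (1 / 2) * (P.omega x (P.prLbar x v) (P.prL x w)
              + P.omega x (P.prLbar x w) (P.prL x v)) ∧
          A.metric x v w = (1 / 2) * P.γ x v w) ∧
        (∀ f : M → ℝ, ContMDiff 𝓘(ℝ, E) 𝓘(ℝ, ℝ) ∞ f → ∀ x : M,
          A.del f x = ParaHerm.sharp (P.omega x) ((mvfderiv 𝓘(ℝ, E) f x).comp (P.prL x))) ∧
        (∀ (X Y : Cₛ^∞⟮𝓘(ℝ, E); E, (TangentSpace 𝓘(ℝ, E) : M → Type _)⟯) (x : M),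
          A.bracket X Y x = ParaHerm.lieForm 𝓘(ℝ, E) P.prL P.prLbar P.omega X Y
            (fun y => (1 / 2) * P.omega y (X y) (Y y)) x ∧
          A.bracket X Y x = ParaHerm.contractedForm 𝓘(ℝ, E) P.prL P.prLbar P.omega X Y
            (fun y => (1 / 2) * P.omega y (X y) (Y y)) x ∧
          A.dorfman X Y x = ParaHerm.lieForm 𝓘(ℝ, E) P.prL P.prLbar P.omega X Y
            (fun y => P.omega y (P.prLbar y (X y)) (P.prL y (Y y))) x ∧
          A.dorfman X Y x = ParaHerm.contractedForm 𝓘(ℝ, E) P.prL P.prLbar P.omega X Y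
            (fun y => P.omega y (P.prLbar y (X y)) (P.prL y (Y y))) x)) ∧
      -- the structure of the foliation `L̄`
      (ParaHerm.IsTransfer 𝓘(ℝ, E) P.Lbar B P.toBigLbar ∧
        (∀ (x : M) (Y : P.Lbar x), ∀ α ∈ ParaHerm.ann 𝓘(ℝ, E) P.L x,
          P.toBigLbar x ((Y : TangentSpace 𝓘(ℝ, E) x) - ParaHerm.sharp (P.omega x) α)
            = (Y, ParaHerm.cls 𝓘(ℝ, E) P.Lbar x α)) ∧
        B.anchor = P.prLbar ∧
        (∀ (x : M) (v w : TangentSpace 𝓘(ℝ, E) x),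
          B.metric x v w = (1 / 2) * (-P.omega x (P.prL x v) (P.prLbar x w)
              - P.omega x (P.prL x w) (P.prLbar x v)) ∧
          B.metric x v w = (1 / 2) * P.γ x v w) ∧
        (∀ f : M → ℝ, ContMDiff 𝓘(ℝ, E) 𝓘(ℝ, ℝ) ∞ f → ∀ x : M,
          B.del f x = -ParaHerm.sharp (P.omega x) ((mvfderiv 𝓘(ℝ, E) f x).comp (P.prLbar x))) ∧
        (∀ (X Y : Cₛ^∞⟮𝓘(ℝ, E); E, (TangentSpace 𝓘(ℝ, E) : M → Type _)⟯) (x : M),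
          B.bracket X Y x = ParaHerm.lieForm 𝓘(ℝ, E) P.prLbar P.prL P.omega X Y
            (fun y => (1 / 2) * P.omega y (X y) (Y y)) x ∧
          B.bracket X Y x = ParaHerm.contractedForm 𝓘(ℝ, E) P.prLbar P.prL P.omega X Y
            (fun y => (1 / 2) * P.omega y (X y) (Y y)) x ∧
          B.dorfman X Y x = ParaHerm.lieForm 𝓘(ℝ, E) P.prLbar P.prL P.omega X Y
            (fun y => P.omega y (P.prL y (X y)) (P.prLbar y (Y y))) x ∧
          B.dorfman X Y x = ParaHerm.contractedForm 𝓘(ℝ, E) P.prLbar P.prL P.omega X Y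
            (fun y => P.omega y (P.prL y (X y)) (P.prLbar y (Y y))) x)) := by
  refine ⟨P.splitting.courantAlgebroid, P.oppositeSplitting.courantAlgebroid,
    ⟨P.splitting.isTransfer, fun x Y α hα => P.toBigL_add_sharp Y hα, rfl,
      fun x v w => ⟨P.splitting.g_apply x v w, rfl⟩, fun f _ x => P.splitting.del_eq f x,
      fun X Y x => ⟨?_, ?_, ?_, ?_⟩⟩,
    P.oppositeSplitting.isTransfer, fun x Y α hα => P.toBigLbar_sub_sharp Y hα, rfl,
      fun x v w => ⟨?_, rfl⟩, fun f _ x => P.oppositeSplitting_del f x,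
      fun X Y x => ⟨?_, ?_, ?_, ?_⟩⟩
  · exact P.splitting.bracket_eq X Y x
  · exact (P.splitting.bracket_eq X Y x).trans (P.lieForm_eq_contractedForm X Y _ x)
  · exact P.splitting.dorfmanField_apply X Y x
  · exact (P.splitting.dorfmanField_apply X Y x).trans (P.lieForm_eq_contractedForm X Y _ x)
  · exact P.oppositeSplitting.g_apply x v w
  · exact P.oppositeSplitting_bracket X Y x
  · exact (P.oppositeSplitting_bracket X Y x).trans
      (P.opposite_lieForm_eq_contractedForm X Y _ x)
  · exact P.oppositeSplitting_dorfman X Y x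
  · exact (P.oppositeSplitting_dorfman X Y x).trans
      (P.opposite_lieForm_eq_contractedForm X Y _ x)
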